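/- **Setting.** Let $\mathcal X,\mathcal A$ be finite non-empty sets, $T,H\ge 1$, and for $h\in[H]$ let $\mathcal F^h$ be a finite non-empty class of functions $\mathcal X\times\mathcal A\to[0,L]$, $\mathcal N=\max_h|\mathcal F^h|$. Fix $\lambda>0$. A weighted dataset $\mathcal Z$ is a finite multiset of pairs $(z,\sigma)$, $z\in\mathcal X\times\mathcal A$, $\sigma>0$; put $\|g\|_{\mathcal Z}^2=\sum_{(z,\sigma)\in\mathcal Z}g(z)^2/\sigma^2$ and $$D_{\mathcal F}^2(z;\mathcal Z)=\sup_{f_1,f_2\in\mathcal F}\frac{(f_1(z)-f_2(z))^2}{\|f_1-f_2\|_{\mathcal Z}^2+\lambda},\qquad \dim_{\alpha,T}(\mathcal F)=\sup\ \sum_{i=1}^T\min\Bigl(1,\tfrac1{\sigma_i^2}D^2_{\mathcal F}\bigl(z_i;\{(z_s,\sigma_s)\}_{s<i}\bigr)\Bigr),$$ the last supremum being over all $z_1,\dots,z_T$ and all $\sigma_1,\dots,\sigma_T\ge\alpha$. Let $\alpha\ge\sqrt{1/(TH)}$ and $0<\delta<1/(H^2+11)$. **Radii.** Let $0\le\beta_1^h\le\dots\le\beta_T^h$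 be the confidence radii at level $h$, and let $\beta^h$ be the radius parameter of the sub-sampling at level $h$, where, for a constant $K\ge1$, $\beta_t^h\le\beta^h$, $\lambda\le(\beta^h)^2$ and $(\beta^h)^2\le K\bigl((\beta_t^h)^2+\lambda\bigr)$ for all $t\in[T]$. (For example $\beta_t^h=\beta^h\ge\sqrt\lambda$ for all $t$, with $K=1$.) **Online sensitivity sub-sampling.** At each step $t$ and level $h$ a pair $(z_t^h,\bar\sigma_t^h)$ with $\bar\sigma_t^h\ge\alpha$ arrives, which may depend arbitrarily on everything that happened before the coins of step $t$, including all earlier coins. Let $\mathcal Z^h_{[t-1]}=\{(z^h_s,\bar\sigma^h_s)\}_{s<t}$ be the original data and $\hat{\mathcal Z}_{[t-1]}^h$ the current sub-sample, with $\hat{\mathcal Z}^h_{[0]}=\emptyset$. Let $\mathcal R$ be either always $\hat{\mathcal Z}^h_{[t-1]}$ or always $\mathcal Z_{[t-1]}^h$ (the result holds for both versions of the algorithm), let $$\mathrm{sens}=\min\Bigl\{1,\ \sup_{f,f'\in\mathcal F^h}\frac{(f(z_t^h)-f'(z_t^h))^2/(\bar\sigma_t^h)^2}{\min\{\|f-f'\|^2_{\mathcal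 R},\,T(H+1)^2/\alpha^2\}+(\beta^h)^2}\Bigr\},$$ and let $p$ be the smallest real with $1/p\in\mathbb Z$ and $p\ge\min\bigl(1,C_{\rm alg}\cdot\mathrm{sens}\cdot\log(T\mathcal N/\delta)\bigr)$ ($p=0$ if $\mathrm{sens}=0$). With conditional probability $p$ given the past, add $1/p$ copies of $(z_t^h,\bar\sigma_t^h)$ to $\hat{\mathcal Z}_{[t-1]}^h$ to get $\hat{\mathcal Z}_{[t]}^h$; otherwise $\hat{\mathcal Z}_{[t]}^h=\hat{\mathcal Z}_{[t-1]}^h$. The bonus at iteration $t$ is $$b_t^h(z)=\max\Bigl\{|f_1(z)-f_2(z)|:\ f_1,f_2\in\mathcal F^h,\ \sum_{(z',\sigma)\in\hat{\mathcal Z}_{[t-1]}^h}\rho(\sigma)\,(f_1(z')-f_2(z'))^2\le 10^2(\beta^h)^2\Bigr\},$$ where $\rho(\sigma)$ is $1/\sigma^2$ rounded down to an integer power of two, and $\rho(\sigma)=0$ if $1/\sigma^2<\lambda/(TL^2)$. **Claim.** There are constants $C_{\rm alg}\ge1$ and $C_{\mathcal W}>0$ depending only on $L,\lambda$, and $C>0$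 depending only on $L,\lambda,K$, such that, for all data as above, there is a finite class $\mathcal W$ of functions on $\mathcal X\times\mathcal A$, not depending on the data process, with $$\log|\mathcal W|\le C_{\mathcal W}\cdot\max\bigl\{1,\max_{h\in[H]}\dim_{\alpha,T}(\mathcal F^h)\bigr\}\cdot\log\frac{T\mathcal N}{\delta}\cdot\log\frac{T|\mathcal X\times\mathcal A|}{\delta},$$ and for every adaptive data process, with probability at least $1-\delta$, the $b_t^h$ are the outputs of a consistent bonus oracle with error $\varepsilon_{\rm b}=0$, simultaneously for all $t\in[T]$, $h\in[H]$. That is, for all $t\in[T]$, $h\in[H]$, $z\in\mathcal X\times\mathcal A$ and every centre $\hat f\in\mathcal F^h$: 1. $b_t^h\in\mathcal W$ and $b_t^h\ge0$; 2. $b_t^h(z)\ge|f(z)-\hat f(z)|$ for every $f\in\mathcal F^h$ with $\|f-\hat f\|^2_{\mathcal Z_{[t-1]}^h}\le(\beta_t^h)^2$; 3. $b_t^h(z)\le C\cdot D_{\mathcal F^h}(z;\mathcal Z_{[t-1]}^h)\sqrt{(\beta_t^h)^2+\lambda}$; 4. (consistency) $b_{t'}^h(z)\le b_t^h(z)$ for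 all $t<t'\le T$. -/

import Mathlib

noncomputable section

namespace BonusOracle

/-- A weighted dataset over `Z`: a finite multiset of pairs `(z, σ(z))`. -/
abbrev WData (Z : Type*) := Multiset (Z × ℝ)

/-- `‖g‖²_𝒵 = ∑_{(z,σ) ∈ 𝒵} g(z)² / σ²`. -/
def wnormSq {Z : Type*} (D : WData Z) (g : Z → ℝ) : ℝ :=
  (D.map fun p => (g p.1) ^ 2 / p.2 ^ 2).sum

/-- The first `t` observations `(w 0, …, w (t-1))` of a sequence, as a weighted dataset. -/
def prefixData {Z : Type*} (w : ℕ → Z × ℝ) (t : ℕ) : WData Z :=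
  (Multiset.range t).map w

/-- `D²_F(z; 𝒵) = sup_{f₁,f₂ ∈ F} (f₁(z) - f₂(z))² / (‖f₁ - f₂‖²_𝒵 + λ)`. -/
def uncertaintySq {Z : Type*} (F : Finset (Z → ℝ)) (lam : ℝ) (D : WData Z) (z : Z) : ℝ :=
  ⨆ f : F × F, (f.1.1 z - f.2.1 z) ^ 2 / (wnormSq D (f.1.1 - f.2.1) + lam)

/-- `D_F(z; 𝒵)`, the square root of `D²_F(z; 𝒵)`. -/
def uncertainty {Z : Type*} (F : Finset (Z → ℝ)) (lam : ℝ) (D : WData Z) (z : Z) : ℝ :=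
  Real.sqrt (uncertaintySq F lam D z)

/-- `dim(F, Z, σ)` for a sequence `w i = (z_i, σ_i)`, `i < T`. -/
def eluderSum {Z : Type*} (F : Finset (Z → ℝ)) (lam : ℝ) (T : ℕ) (w : ℕ → Z × ℝ) : ℝ :=
  ∑ i ∈ Finset.range T,
    min 1 (1 / (w i).2 ^ 2 * uncertaintySq F lam (prefixData w i) (w i).1)

/-- Generalized Eluder dimension `dim_{α,T}(F)`: the supremum of `dim(F, Z, σ)` over all sequences
with `σ ≥ α`. Every `dim(F, Z, σ)` is at most `T`, so the supremum is a finite one. -/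
def genEluderDim {Z : Type*} (F : Finset (Z → ℝ)) (lam α : ℝ) (T : ℕ) : ℝ :=
  ⨆ w : {w : ℕ → Z × ℝ // ∀ i, α ≤ (w i).2}, eluderSum F lam T w.1

/-- `𝒩 = max_h |F^h|`. -/
def maxCard {Z : Type*} {H : ℕ} (F : Fin H → Finset (Z → ℝ)) : ℕ :=
  Finset.univ.sup fun h => (F h).card

/-- Numerical inputs of the sub-sampling algorithm: number of episodes `T`, horizon `H`, size `N` of
the function class, oversampling constant `C`, radius `β`, threshold `α`, failure probability `δ`. -/
structure Params where
  T : ℕ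
  H : ℕ
  N : ℕ
  C : ℝ
  β : ℝ
  α : ℝ
  δ : ℝ

/-- Weighted sensitivity score of `(z, σ)` relative to the weighted dataset `D`. -/
def sensitivity {Z : Type*} (P : Params) (F : Finset (Z → ℝ)) (D : WData Z) (z : Z) (σ : ℝ) : ℝ :=
  min (⨆ f : F × F, 1 / σ ^ 2 * (f.1.1 z - f.2.1 z) ^ 2 /
      (min (wnormSq D (f.1.1 - f.2.1)) (P.T * (P.H + 1) ^ 2 / P.α ^ 2) + P.β ^ 2)) 1

/-- `min(1, C · sensitivity · log(TN/δ))`. -/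
def targetProb {Z : Type*} (P : Params) (F : Finset (Z → ℝ)) (D : WData Z) (z : Z) (σ : ℝ) : ℝ :=
  min 1 (P.C * sensitivity P F D z σ * Real.log (P.T * P.N / P.δ))

/-- The number `1/p` of copies, where `p` is the smallest real number `≥ q` such that `1/p` is an
integer (see `isLeast_invFloor`). For `q = 0` this gives `0` copies and `p = 0`: a point of
sensitivity zero is never added. -/
def copies (q : ℝ) : ℕ := ⌊1 / q⌋₊

theorem isLeast_invFloor {q : ℝ} (hq : 0 < q) (hq1 : q ≤ 1) :
    IsLeast {p : ℝ | 0 < p ∧ q ≤ p ∧ ∃ n : ℤ, 1 / p = n} (1 / (copies q : ℝ)) := by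
  have h1 : (1 : ℝ) ≤ 1 / q := by rw [le_div_iff₀ hq]; linarith
  have hn : 1 ≤ ⌊1 / q⌋₊ := Nat.le_floor (by exact_mod_cast h1)
  have hn' : (0 : ℝ) < (⌊1 / q⌋₊ : ℝ) := by exact_mod_cast hn
  have hfl : (⌊1 / q⌋₊ : ℝ) ≤ 1 / q := Nat.floor_le (by positivity)
  unfold copies
  refine ⟨⟨by positivity, ?_, (⌊1 / q⌋₊ : ℤ), by push_cast; simp⟩, ?_⟩
  · rw [le_div_iff₀ hn']
    rw [le_div_iff₀ hq] at hfl
    linarith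
  · rintro p ⟨hp, hqp, n, hpn⟩
    have hnpos : (0 : ℝ) < n := by rw [← hpn]; positivity
    have hnpos' : 0 < n := by exact_mod_cast hnpos
    have hle : 1 / p ≤ 1 / q := one_div_le_one_div_of_le hq hqp
    obtain ⟨m, rfl⟩ := Int.eq_ofNat_of_zero_le hnpos'.le
    have hm : m ≤ ⌊1 / q⌋₊ := Nat.le_floor (by rw [hpn] at hle; exact_mod_cast hle)
    have hm' : (m : ℝ) ≤ (⌊1 / q⌋₊ : ℝ) := by exact_mod_cast hm
    have hpm : p = 1 / (m : ℝ) := by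
      have : 1 / p = (m : ℝ) := by exact_mod_cast hpn
      rw [← this]; simp
    rw [hpm]
    exact one_div_le_one_div_of_le (by exact_mod_cast hnpos) hm'

/-- The dataset relative to which the sensitivity of a new point is computed: the original data
(`full = true`) or the current sub-sampled data (`full = false`). -/
def refData {Z : Type*} (full : Bool) (D Dhat : WData Z) : WData Z :=
  if full then D else Dhat

/-- Target sampling probability of the observation `w t`, given the current sub-sample `Dhat`. -/
def stepProb {Z : Type*} (P : Params) (F : Finset (Z → ℝ)) (full : Bool)
    (w : ℕ → Z × ℝ) (t : ℕ) (Dhat : WData Z) : ℝ :=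
  targetProb P F (refData full (prefixData w t) Dhat) (w t).1 (w t).2

open Classical in
/-- The online sub-sample obtained from the first `t` observations: `add s` says whether the
coin of step `s` came up "add", in which case `1/p` copies of `w s` are added. -/
def subsample {Z : Type*} (P : Params) (F : Finset (Z → ℝ)) (full : Bool)
    (w : ℕ → Z × ℝ) (add : ℕ → Prop) : ℕ → WData Z
  | 0 => 0
  | t + 1 =>
      if add t then
        subsample P F full w add t +
          Multiset.replicate
            (copies (stepProb P F full w t (subsample P F full w add t))) (w t)
      else subsample P F full w add t

/-- The probability `p` with which the observation `w t` is added to the sub-sample. -/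
def addProb {Z : Type*} (P : Params) (F : Finset (Z → ℝ)) (full : Bool)
    (w : ℕ → Z × ℝ) (add : ℕ → Prop) (t : ℕ) : ℝ :=
  1 / (copies (stepProb P F full w t (subsample P F full w add t)) : ℝ)

/-- The weight `1/σ²` rounded down to an integer power of two; weights below `κ` are dropped. -/
def roundedWeight (κ σ : ℝ) : ℝ :=
  if 1 / σ ^ 2 < κ then 0 else (2 : ℝ) ^ Int.log 2 (1 / σ ^ 2)

/-- `‖g‖²` over a weighted dataset, with rounded weights. -/
def roundedNormSq {Z : Type*} (κ : ℝ) (D : WData Z) (g : Z → ℝ) : ℝ :=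
  (D.map fun p => roundedWeight κ p.2 * (g p.1) ^ 2).sum

/-- The bonus computed from a sub-sampled dataset: the largest gap at `z` between two functions of
`F` whose (rounded) squared distance on the sub-sample is at most `10² β²`. -/
def subsampleBonus {Z : Type*} (F : Finset (Z → ℝ)) (κ β : ℝ) (Dhat : WData Z) (z : Z) : ℝ :=
  sSup {y : ℝ | ∃ f₁ ∈ F, ∃ f₂ ∈ F,
    roundedNormSq κ Dhat (f₁ - f₂) ≤ 10 ^ 2 * β ^ 2 ∧ y = |f₁ z - f₂ z|}

/-- The three requirements on the output `b` of a bonus oracle with bonus class `W`, constant `C`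
and error `εb`, called on the weighted dataset `D`, the class `F`, the centre `fhat` and the
radius `β`. -/
structure IsBonus {Z : Type*} (W : Finset (Z → ℝ)) (C lam εb : ℝ) (F : Finset (Z → ℝ))
    (D : WData Z) (fhat : Z → ℝ) (β : ℝ) (b : Z → ℝ) : Prop where
  mem : b ∈ W
  nonneg : ∀ z, 0 ≤ b z
  dominates : ∀ z, ∀ f ∈ F, wnormSq D (f - fhat) ≤ β ^ 2 → |f z - fhat z| ≤ b z
  le : ∀ z, b z ≤ C * (uncertainty F lam D z * Real.sqrt (β ^ 2 + lam) + εb * β)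

/-- Along one realization of the data (`w h s` is the `s`-th weighted observation at level `h`), the
bonuses `b h t` computed at the iterations `t < T` from the first `t` observations are valid outputs
of a bonus oracle, whatever the centre in `F h`, and are consistent, i.e. pointwise nonincreasing
in `t`. -/
structure IsConsistentBonusFamily {Z : Type*} {H : ℕ} (W : Finset (Z → ℝ)) (C lam εb : ℝ) (T : ℕ)
    (F : Fin H → Finset (Z → ℝ)) (w : Fin H → ℕ → Z × ℝ) (β : Fin H → ℕ → ℝ)
    (b : Fin H → ℕ → Z → ℝ) : Prop where
  isBonus : ∀ h, ∀ t < T, ∀ fhat ∈ F h,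
    IsBonus W C lam εb (F h) (prefixData (w h) t) fhat (β h t) (b h t)
  consistent : ∀ h t t', t < t' → t' < T → ∀ z, b h t' z ≤ b h t z

end BonusOracle

end

/-!
Adding `n` copies with probability `1 / n` keeps `‖f - f'‖²` on the sub-sample an unbiased estimate
of its value on the data. At each dyadic scale `2 ^ i β²` the increments are truncated at a small
multiple of `2 ^ i β²`, so that an exponential supermartingale controls the truncated sums uniformly
over pairs of functions, scales and steps. The truncation has no effect: as long as the two
distances agree up to constants, the sensitivity bounds the next increment, and the agreement
propagates by induction on the step. It turns the constraint that defines the bonus into one on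
the data, which gives validity and sharpness; consistency holds because the sub-sample only grows.

The number of distinct sampled observations concentrates around the sum of the sampling
probabilities, which is at most a logarithmic factor times the generalized Eluder dimension. Since
the weights are rounded to powers of two, a bonus is thus described by few triples of a point,
an exponent and a multiplicity, and the class of all such bonuses is small.
-/

noncomputable section

namespace BonusOracle

open MeasureTheory
open scoped ENNReal

section Coins

variable {Ω : Type*} {m mΩ : MeasurableSpace Ω} {μ : Measure Ω}

/-- `E` is the event that a coin tossed after the past `m` comes up, its conditional probability
being `p`. -/
structure IsCoin (μ : Measure[mΩ] Ω) (m : MeasurableSpace Ω) (E : Set Ω) (p : Ω → ℝ) : Prop where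
  le : m ≤ mΩ
  measurableSet : MeasurableSet[mΩ] E
  condExp_eq : μ[E.indicator (fun _ => (1 : ℝ)) | m] =ᵐ[μ] p

theorem mul_exp_sub_add_mul_exp_neg_le_one {p a c : ℝ} (h : (Real.exp a - 1) * p ≤ c) :
    p * Real.exp (a - c) + (1 - p) * Real.exp (-c) ≤ 1 :=
  calc p * Real.exp (a - c) + (1 - p) * Real.exp (-c)
      = Real.exp (-c) * ((Real.exp a - 1) * p + 1) := by
        rw [sub_eq_add_neg a, Real.exp_add]
        ring
    _ ≤ Real.exp (-c) * Real.exp c := by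
        gcongr
        linarith [Real.add_one_le_exp c]
    _ = 1 := by rw [← Real.exp_add, neg_add_cancel, Real.exp_zero]

namespace IsCoin

variable {E : Set Ω} {p : Ω → ℝ}

theorem nonneg (h : IsCoin μ m E p) : ∀ᵐ ω ∂μ, 0 ≤ p ω := by
  have hcond : 0 ≤ᵐ[μ] μ[E.indicator (fun _ => (1 : ℝ)) | m] :=
    condExp_nonneg (ae_of_all μ (Set.indicator_nonneg fun _ _ => zero_le_one))
  filter_upwards [hcond, h.condExp_eq] with ω hω hp
  rwa [← hp]

theorem aemeasurable (h : IsCoin μ m E p) : AEMeasurable p μ :=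
  integrable_condExp.aemeasurable.congr h.condExp_eq

variable [IsProbabilityMeasure μ]

theorem compl (h : IsCoin μ m E p) : IsCoin μ m Eᶜ (fun ω => 1 - p ω) where
  le := h.le
  measurableSet := h.measurableSet.compl
  condExp_eq := by
    have hsub := condExp_sub (integrable_const (1 : ℝ))
      ((integrable_const (1 : ℝ)).indicator h.measurableSet) m (μ := μ)
    rw [← Pi.one_def, ← Set.indicator_compl, Pi.one_def, condExp_const h.le] at hsub
    filter_upwards [hsub, h.condExp_eq] with ω hω hp
    rw [hω, Pi.sub_apply, hp]

theorem le_one (h : IsCoin μ m E p) : ∀ᵐ ω ∂μ, p ω ≤ 1 :=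
  h.compl.nonneg.mono fun _ hω => by linarith

theorem measure_inter (h : IsCoin μ m E p) {S : Set Ω} (hS : MeasurableSet[m] S) :
    μ (S ∩ E) = ∫⁻ ω in S, ENNReal.ofReal (p ω) ∂μ := by
  have hind : (fun ω => ENNReal.ofReal (E.indicator (fun _ => (1 : ℝ)) ω)) = E.indicator 1 := by
    ext ω; by_cases hω : ω ∈ E <;> simp [hω]
  have hcond := condLExp_ofReal (μ := μ) m
    ((integrable_const (1 : ℝ)).indicator h.measurableSet)
    (ae_of_all μ (Set.indicator_nonneg (s := E) fun _ _ => zero_le_one))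
  calc μ (S ∩ E) = ∫⁻ ω in S, E.indicator 1 ω ∂μ := by
        rw [lintegral_indicator_one h.measurableSet, Measure.restrict_apply h.measurableSet,
          Set.inter_comm]
    _ = ∫⁻ ω in S, μ⁻[E.indicator 1 | m] ω ∂μ := (setLIntegral_condLExp h.le μ _ hS).symm
    _ = ∫⁻ ω in S, ENNReal.ofReal (p ω) ∂μ := by
        refine lintegral_congr_ae (ae_restrict_of_ae ?_)
        rw [← hind]
        filter_upwards [hcond, h.condExp_eq] with ω hω hp
        rw [hω, hp]

theorem setLIntegral_eq (h : IsCoin μ m E p) {φ : Ω → ℝ≥0∞} (hφ : Measurable[m] φ) :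
    ∫⁻ ω in E, φ ω ∂μ = ∫⁻ ω, ENNReal.ofReal (p ω) * φ ω ∂μ := by
  have htrim : (μ.restrict E).trim h.le
      = (μ.withDensity fun ω => ENNReal.ofReal (p ω)).trim h.le := by
    refine @Measure.ext _ m _ _ fun S hS => ?_
    rw [trim_measurableSet_eq h.le hS, trim_measurableSet_eq h.le hS,
      Measure.restrict_apply (h.le S hS), withDensity_apply _ (h.le S hS), h.measure_inter hS]
  calc ∫⁻ ω in E, φ ω ∂μ
      = ∫⁻ ω, φ ω ∂(μ.withDensity fun ω => ENNReal.ofReal (p ω)) := by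
        rw [← lintegral_trim h.le hφ, htrim, lintegral_trim h.le hφ]
    _ = ∫⁻ ω, ENNReal.ofReal (p ω) * φ ω ∂μ :=
        lintegral_withDensity_eq_lintegral_mul₀ h.aemeasurable.ennreal_ofReal
          (hφ.mono h.le le_rfl).aemeasurable

theorem measure_sdiff_eq_zero (h : IsCoin μ m E p) {S : Set Ω} (hS : MeasurableSet[m] S)
    (hone : ∀ ω ∈ S, p ω = 1) : μ (S \ E) = 0 := by
  rw [Set.sdiff_eq, h.compl.measure_inter hS]
  refine (setLIntegral_congr_fun (h.le S hS) fun ω hω => ?_).trans lintegral_zero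
  simp [hone ω hω]

theorem lintegral_mul_exp_le (h : IsCoin μ m E p) {φ : Ω → ℝ≥0∞} {a c : Ω → ℝ}
    (hφ : Measurable[m] φ) (ha : Measurable[m] a) (hc : Measurable[m] c)
    (hac : ∀ ω, (Real.exp (a ω) - 1) * p ω ≤ c ω) :
    ∫⁻ ω, φ ω * ENNReal.ofReal (Real.exp (E.indicator a ω - c ω)) ∂μ ≤ ∫⁻ ω, φ ω ∂μ := by
  have hmeas : ∀ f : Ω → ℝ, Measurable[m] f →
      Measurable[m] fun ω => φ ω * ENNReal.ofReal (Real.exp (f ω)) := fun f hf =>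
    hφ.mul (ENNReal.measurable_ofReal.comp (Real.measurable_exp.comp hf))
  have hup := hmeas (fun ω => a ω - c ω) (ha.sub hc)
  have hdown := hmeas (fun ω => -c ω) hc.neg
  calc ∫⁻ ω, φ ω * ENNReal.ofReal (Real.exp (E.indicator a ω - c ω)) ∂μ
      = ∫⁻ ω in E, φ ω * ENNReal.ofReal (Real.exp (a ω - c ω)) ∂μ
        + ∫⁻ ω in Eᶜ, φ ω * ENNReal.ofReal (Real.exp (-c ω)) ∂μ := by
        rw [← lintegral_add_compl (μ := μ) _ h.measurableSet]
        congr 1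
        · refine setLIntegral_congr_fun h.measurableSet fun ω hω => ?_
          simp only [Set.indicator_of_mem hω]
        · refine setLIntegral_congr_fun h.measurableSet.compl fun ω hω => ?_
          simp only [Set.indicator_of_notMem hω, zero_sub]
    _ = ∫⁻ ω, (ENNReal.ofReal (p ω) * (φ ω * ENNReal.ofReal (Real.exp (a ω - c ω)))
        + ENNReal.ofReal (1 - p ω) * (φ ω * ENNReal.ofReal (Real.exp (-c ω)))) ∂μ := by
        rw [h.setLIntegral_eq hup, h.compl.setLIntegral_eq hdown, ← lintegral_add_left']
        exact h.aemeasurable.ennreal_ofReal.mul (hup.mono h.le le_rfl).aemeasurable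
    _ ≤ ∫⁻ ω, φ ω ∂μ := by
        refine lintegral_mono_ae ?_
        filter_upwards [h.nonneg, h.le_one] with ω hp₀ hp₁
        have hmean := mul_exp_sub_add_mul_exp_neg_le_one (hac ω)
        rw [mul_left_comm, mul_left_comm _ (φ ω), ← mul_add, ← ENNReal.ofReal_mul hp₀,
          ← ENNReal.ofReal_mul (by linarith), ← ENNReal.ofReal_add (by positivity)
            (mul_nonneg (by linarith) (Real.exp_pos _).le)]
        exact mul_le_of_le_one_right' (ENNReal.ofReal_le_one.2 hmean)

end IsCoin

/-- For `s < T`, a coin `E s` is tossed at time `s`, after the past `𝓖 s`, and comes up with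
conditional probability `p s`. -/
structure IsCoinSequence (μ : Measure Ω) (𝓖 : Filtration ℕ mΩ) (T : ℕ) (E : ℕ → Set Ω)
    (p : ℕ → Ω → ℝ) : Prop where
  measurableSet : ∀ s < T, MeasurableSet[𝓖 (s + 1)] (E s)
  condExp_eq : ∀ s < T, μ[(E s).indicator (fun _ => (1 : ℝ)) | 𝓖 s] =ᵐ[μ] p s

namespace IsCoinSequence

variable {𝓖 : Filtration ℕ mΩ} {T t : ℕ} {E : ℕ → Set Ω} {p a c : ℕ → Ω → ℝ}

theorem isCoin (h : IsCoinSequence μ 𝓖 T E p) {s : ℕ} (hs : s < T) :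
    IsCoin μ (𝓖 s) (E s) (p s) :=
  ⟨𝓖.le s, 𝓖.le (s + 1) _ (h.measurableSet s hs), h.condExp_eq s hs⟩

theorem measurable_sum (h : IsCoinSequence μ 𝓖 T E p) (ha : ∀ s < T, Measurable[𝓖 s] (a s))
    (hc : ∀ s < T, Measurable[𝓖 s] (c s)) (ht : t ≤ T) :
    Measurable[𝓖 t] fun ω => ∑ s ∈ Finset.range t, ((E s).indicator (a s) ω - c s ω) := by
  refine Finset.measurable_fun_sum _ fun s hs => ?_
  have hst := Finset.mem_range.1 hs
  have hE : MeasurableSet[𝓖 t] (E s) := 𝓖.mono hst _ (h.measurableSet s (hst.trans_le ht))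
  exact (((ha s (hst.trans_le ht)).mono (𝓖.mono hst.le) le_rfl).indicator hE).sub
    ((hc s (hst.trans_le ht)).mono (𝓖.mono hst.le) le_rfl)

variable [IsProbabilityMeasure μ]

theorem lintegral_exp_sum_le_one (h : IsCoinSequence μ 𝓖 T E p)
    (ha : ∀ s < T, Measurable[𝓖 s] (a s)) (hc : ∀ s < T, Measurable[𝓖 s] (c s))
    (hac : ∀ s < T, ∀ ω, (Real.exp (a s ω) - 1) * p s ω ≤ c s ω) (ht : t ≤ T) :
    ∫⁻ ω, ENNReal.ofReal
      (Real.exp (∑ s ∈ Finset.range t, ((E s).indicator (a s) ω - c s ω))) ∂μ ≤ 1 := by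
  induction t with
  | zero => simp
  | succ t ih =>
    simp only [Finset.sum_range_succ, Real.exp_add, ENNReal.ofReal_mul (Real.exp_pos _).le]
    exact ((h.isCoin ht).lintegral_mul_exp_le
      (ENNReal.measurable_ofReal.comp
        (Real.measurable_exp.comp (h.measurable_sum ha hc (Nat.le_of_succ_le ht))))
      (ha t ht) (hc t ht) (hac t ht)).trans (ih (Nat.le_of_succ_le ht))

theorem measureReal_mul_le_sum_le (h : IsCoinSequence μ 𝓖 T E p)
    (ha : ∀ s < T, Measurable[𝓖 s] (a s)) (hc : ∀ s < T, Measurable[𝓖 s] (c s)) {b : ℝ}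
    (hb : 0 < b) (hac : ∀ s < T, ∀ ω, (Real.exp (a s ω / b) - 1) * p s ω ≤ c s ω / b)
    (ht : t ≤ T) (l : ℝ) :
    μ.real {ω | b * l ≤ ∑ s ∈ Finset.range t, ((E s).indicator (a s) ω - c s ω)}
      ≤ Real.exp (-l) := by
  have ha' : ∀ s < T, Measurable[𝓖 s] fun ω => a s ω / b := fun s hs => (ha s hs).div_const b
  have hc' : ∀ s < T, Measurable[𝓖 s] fun ω => c s ω / b := fun s hs => (hc s hs).div_const b
  set S : Ω → ℝ := fun ω =>
    ∑ s ∈ Finset.range t, ((E s).indicator (fun ω => a s ω / b) ω - c s ω / b) with hS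
  have hscale : ∀ ω, ∑ s ∈ Finset.range t, ((E s).indicator (a s) ω - c s ω) = b * S ω := by
    intro ω
    rw [hS, Finset.mul_sum]
    refine Finset.sum_congr rfl fun s _ => ?_
    by_cases hω : ω ∈ E s <;> simp [hω] <;> field_simp
  have hset : {ω | b * l ≤ ∑ s ∈ Finset.range t, ((E s).indicator (a s) ω - c s ω)}
      = {ω | ENNReal.ofReal (Real.exp l) ≤ ENNReal.ofReal (Real.exp (S ω))} := by
    ext ω
    simp only [Set.mem_ofPred_eq, hscale, mul_le_mul_iff_right₀ hb,
      ENNReal.ofReal_le_ofReal_iff (Real.exp_pos _).le, Real.exp_le_exp]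
  have hSm : Measurable S := (h.measurable_sum ha' hc' ht).mono (𝓖.le t) le_rfl
  have hmarkov := meas_ge_le_lintegral_div (μ := μ) hSm.exp.ennreal_ofReal.aemeasurable
    (ENNReal.ofReal_pos.2 (Real.exp_pos l)).ne' ENNReal.ofReal_ne_top
  refine ENNReal.toReal_le_of_le_ofReal (Real.exp_pos _).le ?_
  calc μ {ω | b * l ≤ ∑ s ∈ Finset.range t, ((E s).indicator (a s) ω - c s ω)}
      ≤ (∫⁻ ω, ENNReal.ofReal (Real.exp (S ω)) ∂μ) / ENNReal.ofReal (Real.exp l) :=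
        hset ▸ hmarkov
    _ ≤ 1 / ENNReal.ofReal (Real.exp l) := by
        gcongr; exact h.lintegral_exp_sum_le_one ha' hc' hac ht
    _ = ENNReal.ofReal (Real.exp (-l)) := by
        rw [one_div, Real.exp_neg, ENNReal.ofReal_inv_of_pos (Real.exp_pos l)]

end IsCoinSequence

end Coins

section SampledSum

open Classical in
/-- The sum of `n s` copies of `x s` over the steps `s < t` at which the coin says "add". -/
def sampledSum (add : ℕ → Prop) (n : ℕ → ℕ) (x : ℕ → ℝ) (t : ℕ) : ℝ :=
  ∑ s ∈ Finset.range t, if add s then n s * x s else 0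

/-- The value `x s`, kept only at the steps at which `n s` is at least two (the coin is random) and
at which `n s` copies of `v s` add up to at most `b`. Concentration is applied to truncated values,
for which the bound on the increments holds on the whole probability space. -/
def truncated (n : ℕ → ℕ) (b : ℝ) (v x : ℕ → ℝ) (s : ℕ) : ℝ :=
  if 2 ≤ n s ∧ n s * v s ≤ b then x s else 0

variable {add : ℕ → Prop} {n : ℕ → ℕ} {b e : ℝ} {v x y : ℕ → ℝ} {s t : ℕ}

theorem sampledSum_le_sampledSum (h : ∀ s < t, x s ≤ y s) :
    sampledSum add n x t ≤ sampledSum add n y t := by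
  refine Finset.sum_le_sum fun s hs => ?_
  split_ifs
  · exact mul_le_mul_of_nonneg_left (h s (Finset.mem_range.1 hs)) (Nat.cast_nonneg _)
  · exact le_rfl

theorem truncated_nonneg (hx : ∀ s, 0 ≤ x s) : 0 ≤ truncated n b v x s := by
  unfold truncated
  split_ifs
  exacts [hx s, le_rfl]

theorem truncated_le (hx : ∀ s, 0 ≤ x s) : truncated n b v x s ≤ x s := by
  unfold truncated
  split_ifs
  exacts [le_rfl, hx s]

theorem mul_truncated_le (hb : 0 ≤ b) (hxv : ∀ s, x s ≤ v s) :
    n s * truncated n b v x s ≤ b := by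
  unfold truncated
  split_ifs with h
  · exact (mul_le_mul_of_nonneg_left (hxv s) (Nat.cast_nonneg _)).trans h.2
  · simpa using hb

theorem truncated_eq_zero (hn : n s < 2) : truncated n b v x s = 0 :=
  if_neg fun h => by omega

theorem truncated_eq_self (hn : 2 ≤ n s) (hv : 2 ≤ n s → n s * v s ≤ b) :
    truncated n b v x s = x s :=
  if_pos ⟨hn, hv hn⟩

theorem sampledSum_le_of_truncated (hx : ∀ s, 0 ≤ x s)
    (hv : ∀ s < t, 2 ≤ n s → n s * v s ≤ b)
    (h : sampledSum add n (truncated n b v x) t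
      ≤ 2 * ∑ s ∈ Finset.range t, truncated n b v x s + e) :
    sampledSum add n x t ≤ 2 * ∑ s ∈ Finset.range t, x s + e := by
  have hterm : sampledSum add n x t ≤ sampledSum add n (truncated n b v x) t
      + ∑ s ∈ Finset.range t, (x s - truncated n b v x s) := by
    rw [sampledSum, sampledSum, ← Finset.sum_add_distrib]
    refine Finset.sum_le_sum fun s hs => ?_
    by_cases hn : 2 ≤ n s
    · rw [truncated_eq_self hn (hv s (Finset.mem_range.1 hs)), sub_self, add_zero]
    · have hn₁ : (n s : ℝ) ≤ 1 := by exact_mod_cast Nat.lt_succ_iff.1 (not_le.1 hn)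
      rw [truncated_eq_zero (not_le.1 hn)]
      split_ifs
      · simpa using mul_le_of_le_one_left (hx s) hn₁
      · simpa using hx s
  have hle : ∑ s ∈ Finset.range t, truncated n b v x s ≤ ∑ s ∈ Finset.range t, x s :=
    Finset.sum_le_sum fun s _ => truncated_le hx
  rw [Finset.sum_sub_distrib] at hterm
  linarith

theorem le_sampledSum_of_truncated (hx : ∀ s, 0 ≤ x s)
    (hv : ∀ s < t, 2 ≤ n s → n s * v s ≤ b) (hone : ∀ s < t, n s = 1 → add s)
    (hzero : ∀ s < t, n s = 0 → x s = 0)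
    (h : (∑ s ∈ Finset.range t, truncated n b v x s) / 2 - e
      ≤ sampledSum add n (truncated n b v x) t) :
    (∑ s ∈ Finset.range t, x s) / 2 - e ≤ sampledSum add n x t := by
  have hterm : sampledSum add n (truncated n b v x) t
      + ∑ s ∈ Finset.range t, (x s - truncated n b v x s) ≤ sampledSum add n x t := by
    rw [sampledSum, sampledSum, ← Finset.sum_add_distrib]
    refine Finset.sum_le_sum fun s hs => ?_
    have hst := Finset.mem_range.1 hs
    obtain hn | hn | hn : n s = 0 ∨ n s = 1 ∨ 2 ≤ n s := by omega
    · simp [truncated_eq_zero (b := b) (v := v) (x := x) (s := s) (by omega : n s < 2),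
        hzero s hst hn]
    · simp [truncated_eq_zero (b := b) (v := v) (x := x) (s := s) (by omega : n s < 2),
        hone s hst hn, hn]
    · rw [truncated_eq_self hn (hv s hst), sub_self, add_zero]
  have hle : ∑ s ∈ Finset.range t, truncated n b v x s ≤ ∑ s ∈ Finset.range t, x s :=
    Finset.sum_le_sum fun s _ => truncated_le hx
  rw [Finset.sum_sub_distrib] at hterm
  linarith

theorem card_le_sampledSum_one_div {S : Finset ℕ} (hS : ∀ s ∈ S, s < t ∧ add s ∧ n s ≠ 0) :
    (S.card : ℝ) ≤ sampledSum add n (fun s => 1 / n s) t := by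
  classical
  calc (S.card : ℝ) = ∑ s ∈ S, if add s then n s * (1 / n s : ℝ) else 0 := by
        rw [Finset.cast_card]
        refine Finset.sum_congr rfl fun s hs => ?_
        rw [if_pos (hS s hs).2.1, mul_one_div_cancel (Nat.cast_ne_zero.2 (hS s hs).2.2)]
    _ ≤ sampledSum add n (fun s => 1 / n s) t := by
        unfold sampledSum
        refine (Finset.sum_le_sum_of_subset_of_nonneg
          (fun s hs => Finset.mem_range.2 (hS s hs).1) fun s _ _ => ?_).trans (le_of_eq ?_)
        · split_ifs <;> positivity
        · exact Finset.sum_congr rfl fun s _ => by congr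

end SampledSum

section Tails

variable {Ω : Type*} {mΩ : MeasurableSpace Ω} {μ : Measure Ω} [IsProbabilityMeasure μ]
  {𝓖 : Filtration ℕ mΩ} {T t : ℕ} {E : ℕ → Set Ω} {n : ℕ → Ω → ℕ} {x : ℕ → Ω → ℝ} {b : ℝ}

theorem exp_sub_one_le_two_mul {y : ℝ} (h₀ : 0 ≤ y) (h₁ : y ≤ 1) : Real.exp y - 1 ≤ 2 * y := by
  have h := (abs_le.1 (Real.abs_exp_sub_one_sub_id_le (abs_le.2 ⟨by linarith, h₁⟩))).2
  nlinarith

theorem exp_neg_sub_one_le {y : ℝ} (h₀ : 0 ≤ y) (h₁ : y ≤ 1) :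
    Real.exp (-y) - 1 ≤ -(y / 2) := by
  have h := (abs_le.1 (Real.abs_exp_sub_one_sub_id_le (x := -y)
    (abs_le.2 ⟨by linarith, by linarith⟩))).2
  have hexp : Real.exp (-y) * (1 + y) ≤ 1 := by
    calc Real.exp (-y) * (1 + y) ≤ Real.exp (-y) * Real.exp y := by
          gcongr; linarith [Real.add_one_le_exp y]
      _ = 1 := by rw [← Real.exp_add, neg_add_cancel, Real.exp_zero]
  nlinarith [h]

theorem sampledSum_eq_sum_indicator (ω : Ω) :
    sampledSum (fun s => ω ∈ E s) (fun s => n s ω) (fun s => x s ω) t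
      = ∑ s ∈ Finset.range t, (E s).indicator (fun ω => n s ω * x s ω) ω := by
  refine Finset.sum_congr rfl fun s _ => ?_
  by_cases hω : ω ∈ E s <;> simp [hω]

namespace IsCoinSequence

theorem measureReal_le_sampledSum_le (h : IsCoinSequence μ 𝓖 T E fun s ω => 1 / (n s ω : ℝ))
    (hn : ∀ s < T, Measurable[𝓖 s] (n s)) (hx : ∀ s < T, Measurable[𝓖 s] (x s))
    (hx₀ : ∀ s ω, 0 ≤ x s ω) (hb : 0 < b) (hxb : ∀ s ω, n s ω * x s ω ≤ b) (ht : t ≤ T) (l : ℝ) :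
    μ.real {ω | 2 * ∑ s ∈ Finset.range t, x s ω + b * l
      ≤ sampledSum (fun s => ω ∈ E s) (fun s => n s ω) (fun s => x s ω) t} ≤ Real.exp (-l) := by
  have hnx : ∀ s < T, Measurable[𝓖 s] fun ω => n s ω * x s ω := fun s hs =>
    (measurable_from_top.comp (hn s hs)).mul (hx s hs)
  refine (measureReal_mono fun ω hω => ?_).trans
    (h.measureReal_mul_le_sum_le hnx (fun s hs => (hx s hs).const_mul 2) hb
      (fun s _ ω => ?_) ht l)
  · simp only [Set.mem_ofPred_eq, Finset.sum_sub_distrib, ← sampledSum_eq_sum_indicator,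
      ← Finset.mul_sum] at hω ⊢
    linarith
  · have hnx₀ : 0 ≤ n s ω * x s ω := mul_nonneg (Nat.cast_nonneg _) (hx₀ s ω)
    calc (Real.exp (n s ω * x s ω / b) - 1) * (1 / n s ω)
        ≤ 2 * (n s ω * x s ω / b) * (1 / n s ω) := by
          gcongr
          exact exp_sub_one_le_two_mul (div_nonneg hnx₀ hb.le) ((div_le_one hb).2 (hxb s ω))
      _ = n s ω / n s ω * (2 * x s ω / b) := by ring
      _ ≤ 2 * x s ω / b :=
          mul_le_of_le_one_left (div_nonneg (mul_nonneg zero_le_two (hx₀ s ω)) hb.le)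
            (div_self_le_one _)

theorem measureReal_sampledSum_le_le (h : IsCoinSequence μ 𝓖 T E fun s ω => 1 / (n s ω : ℝ))
    (hn : ∀ s < T, Measurable[𝓖 s] (n s)) (hx : ∀ s < T, Measurable[𝓖 s] (x s))
    (hx₀ : ∀ s ω, 0 ≤ x s ω) (hn₀ : ∀ s ω, n s ω = 0 → x s ω = 0) (hb : 0 < b)
    (hxb : ∀ s ω, n s ω * x s ω ≤ b) (ht : t ≤ T) (l : ℝ) :
    μ.real {ω | sampledSum (fun s => ω ∈ E s) (fun s => n s ω) (fun s => x s ω) t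
      ≤ (∑ s ∈ Finset.range t, x s ω) / 2 - b * l} ≤ Real.exp (-l) := by
  have hnx : ∀ s < T, Measurable[𝓖 s] fun ω => -(n s ω * x s ω) := fun s hs =>
    ((measurable_from_top.comp (hn s hs)).mul (hx s hs)).neg
  refine (measureReal_mono fun ω hω => ?_).trans
    (h.measureReal_mul_le_sum_le (c := fun s ω => -(x s ω / 2)) hnx
      (fun s hs => ((hx s hs).div_const 2).neg) hb (fun s _ ω => ?_) ht l)
  · have hneg : ∀ s, (E s).indicator (fun ω => -(n s ω * x s ω)) ω
        = -(E s).indicator (fun ω => n s ω * x s ω) ω := fun s =>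
      congrFun (Set.indicator_neg (E s) _) ω
    simp only [Set.mem_ofPred_eq, hneg, Finset.sum_sub_distrib, Finset.sum_neg_distrib,
      ← sampledSum_eq_sum_indicator, ← Finset.sum_div] at hω ⊢
    linarith
  · rcases eq_or_ne (n s ω) 0 with hns | hns
    · simp [hns, hn₀ s ω hns]
    · have hns' : (0 : ℝ) < n s ω := Nat.cast_pos.2 (Nat.pos_of_ne_zero hns)
      have hnx₀ : 0 ≤ n s ω * x s ω := mul_nonneg hns'.le (hx₀ s ω)
      calc (Real.exp (-(n s ω * x s ω) / b) - 1) * (1 / n s ω)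
          ≤ -(n s ω * x s ω / b / 2) * (1 / n s ω) := by
            rw [neg_div]
            gcongr
            exact exp_neg_sub_one_le (div_nonneg hnx₀ hb.le) ((div_le_one hb).2 (hxb s ω))
        _ = -(x s ω / 2) / b := by field_simp

theorem lintegral_sum_copies_le (h : IsCoinSequence μ 𝓖 T E fun s ω => 1 / (n s ω : ℝ))
    (hn : ∀ s < T, Measurable[𝓖 s] (n s)) :
    ∫⁻ ω, ∑ s ∈ Finset.range T, (E s).indicator (fun ω => (n s ω : ℝ≥0∞)) ω ∂μ ≤ T := by
  have hcast : ∀ s < T, Measurable[𝓖 s] fun ω => (n s ω : ℝ≥0∞) := fun s hs =>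
    measurable_from_top.comp (hn s hs)
  have hE : ∀ s < T, MeasurableSet (E s) := fun s hs => (h.isCoin hs).measurableSet
  rw [lintegral_finsetSum _ fun s hs => ((hcast s (Finset.mem_range.1 hs)).mono
    (𝓖.le s) le_rfl).indicator (hE s (Finset.mem_range.1 hs))]
  calc ∑ s ∈ Finset.range T, ∫⁻ ω, (E s).indicator (fun ω => (n s ω : ℝ≥0∞)) ω ∂μ
      ≤ ∑ _s ∈ Finset.range T, 1 := Finset.sum_le_sum fun s hs => ?_
    _ = (T : ℝ≥0∞) := by simp
  have hs := Finset.mem_range.1 hs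
  rw [lintegral_indicator (hE s hs), (h.isCoin hs).setLIntegral_eq (hcast s hs)]
  calc ∫⁻ ω, ENNReal.ofReal (1 / n s ω) * n s ω ∂μ ≤ ∫⁻ _, 1 ∂μ := lintegral_mono fun ω => ?_
    _ = 1 := by simp
  rw [← ENNReal.ofReal_natCast, ← ENNReal.ofReal_mul (by positivity), one_div_mul_eq_div]
  exact ENNReal.ofReal_le_one.2 (div_self_le_one _)

theorem measureReal_le_sampledSum_one_le
    (h : IsCoinSequence μ 𝓖 T E fun s ω => 1 / (n s ω : ℝ))
    (hn : ∀ s < T, Measurable[𝓖 s] (n s)) (hb : 0 < b) :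
    μ.real {ω | b ≤ sampledSum (fun s => ω ∈ E s) (fun s => n s ω) (fun _ => 1) T} ≤ T / b := by
  have hsum : ∀ ω, ENNReal.ofReal (sampledSum (fun s => ω ∈ E s) (fun s => n s ω) (fun _ => 1) T)
      = ∑ s ∈ Finset.range T, (E s).indicator (fun ω => (n s ω : ℝ≥0∞)) ω := by
    classical
    intro ω
    rw [sampledSum, ENNReal.ofReal_sum_of_nonneg fun s _ => by split_ifs <;> positivity]
    refine Finset.sum_congr rfl fun s _ => ?_
    by_cases hs : ω ∈ E s <;> simp [hs]
  refine ENNReal.toReal_le_of_le_ofReal (by positivity) ?_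
  calc μ {ω | b ≤ sampledSum (fun s => ω ∈ E s) (fun s => n s ω) (fun _ => 1) T}
      ≤ μ {ω | ENNReal.ofReal b
          ≤ ∑ s ∈ Finset.range T, (E s).indicator (fun ω => (n s ω : ℝ≥0∞)) ω} :=
        measure_mono fun ω hω => (ENNReal.ofReal_le_ofReal hω).trans_eq (hsum ω)
    _ ≤ (∫⁻ ω, ∑ s ∈ Finset.range T, (E s).indicator (fun ω => (n s ω : ℝ≥0∞)) ω ∂μ)
          / ENNReal.ofReal b := by
        refine meas_ge_le_lintegral_div (Finset.aemeasurable_fun_sum _ fun s hs => ?_)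
          (ENNReal.ofReal_pos.2 hb).ne' ENNReal.ofReal_ne_top
        have hs := Finset.mem_range.1 hs
        exact (((measurable_from_top.comp (hn s hs)).mono (𝓖.le s) le_rfl).indicator
          (h.isCoin hs).measurableSet).aemeasurable
    _ ≤ T / ENNReal.ofReal b := by gcongr; exact h.lintegral_sum_copies_le hn
    _ = ENNReal.ofReal (T / b) := by
        rw [ENNReal.ofReal_div_of_pos hb, ENNReal.ofReal_natCast]

theorem measureReal_not_add_of_copies_eq_one
    (h : IsCoinSequence μ 𝓖 T E fun s ω => 1 / (n s ω : ℝ))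
    (hn : ∀ s < T, Measurable[𝓖 s] (n s)) :
    μ.real {ω | ¬ ∀ s < T, n s ω = 1 → ω ∈ E s} = 0 := by
  have hset : {ω | ¬ ∀ s < T, n s ω = 1 → ω ∈ E s}
      ⊆ ⋃ s ∈ Finset.range T, {ω | n s ω = 1} \ E s := by
    intro ω hω
    simp only [Set.mem_ofPred_eq, not_forall] at hω
    obtain ⟨s, hs, hns, hωs⟩ := hω
    exact Set.mem_biUnion (Finset.mem_coe.2 (Finset.mem_range.2 hs)) ⟨hns, hωs⟩
  refine (measureReal_eq_zero_iff).2 (measure_mono_null hset ?_)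
  refine (measure_biUnion_null_iff (Finset.range T).countable_toSet).2 fun s hs => ?_
  have hs := Finset.mem_range.1 hs
  exact (h.isCoin hs).measure_sdiff_eq_zero (hn s hs (measurableSet_singleton 1))
    fun ω hω => by simp [show n s ω = 1 from hω]

end IsCoinSequence

end Tails

section Subsample

variable {Z : Type*} {P : Params} {F : Finset (Z → ℝ)} {full : Bool} {w : ℕ → Z × ℝ}
  {add : ℕ → Prop} {κ : ℝ} {s t : ℕ}

/-- The number of copies of the observation `w t` that are added to the sub-sample if the coin of
step `t` says so. -/
def stepCopies (P : Params) (F : Finset (Z → ℝ)) (full : Bool) (w : ℕ → Z × ℝ) (add : ℕ → Prop)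
    (t : ℕ) : ℕ :=
  copies (stepProb P F full w t (subsample P F full w add t))

/-- The contribution `g(z)² / σ²` of the observation `w s = (z, σ)` to a squared norm of `g`. -/
def obsSq (w : ℕ → Z × ℝ) (g : Z → ℝ) (s : ℕ) : ℝ :=
  g (w s).1 ^ 2 / (w s).2 ^ 2

/-- The contribution of the observation `w s` to a squared norm of `g` with rounded weights. -/
def obsRoundedSq (κ : ℝ) (w : ℕ → Z × ℝ) (g : Z → ℝ) (s : ℕ) : ℝ :=
  roundedWeight κ (w s).2 * g (w s).1 ^ 2

theorem wnormSq_nonneg (D : WData Z) (g : Z → ℝ) : 0 ≤ wnormSq D g :=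
  Multiset.sum_nonneg <| Multiset.forall_mem_map_iff.2 fun _ _ => by positivity

theorem obsSq_nonneg (g : Z → ℝ) (s : ℕ) : 0 ≤ obsSq w g s := by
  unfold obsSq
  positivity

theorem wnormSq_prefixData (g : Z → ℝ) (t : ℕ) :
    wnormSq (prefixData w t) g = ∑ s ∈ Finset.range t, obsSq w g s := by
  simp [wnormSq, prefixData, Finset.sum, obsSq]

theorem wnormSq_prefixData_mono (g : Z → ℝ) (h : s ≤ t) :
    wnormSq (prefixData w s) g ≤ wnormSq (prefixData w t) g := by
  rw [wnormSq_prefixData, wnormSq_prefixData]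
  exact Finset.sum_le_sum_of_subset_of_nonneg (Finset.range_mono h) fun i _ _ => obsSq_nonneg g i

theorem sum_map_subsample (φ : Z × ℝ → ℝ) (t : ℕ) :
    ((subsample P F full w add t).map φ).sum
      = sampledSum add (stepCopies P F full w add) (fun s => φ (w s)) t := by
  induction t with
  | zero => simp [subsample, sampledSum]
  | succ t ih =>
    rw [sampledSum, Finset.sum_range_succ, ← sampledSum, ← ih, subsample]
    split_ifs <;> simp [stepCopies]

theorem wnormSq_subsample (g : Z → ℝ) (t : ℕ) :
    wnormSq (subsample P F full w add t) g
      = sampledSum add (stepCopies P F full w add) (obsSq w g) t :=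
  sum_map_subsample _ t

theorem roundedNormSq_subsample (g : Z → ℝ) (t : ℕ) :
    roundedNormSq κ (subsample P F full w add t) g
      = sampledSum add (stepCopies P F full w add) (obsRoundedSq κ w g) t :=
  sum_map_subsample _ t

theorem subsample_mono : Monotone (subsample P F full w add) := by
  refine monotone_nat_of_le_succ fun t => ?_
  rw [subsample]
  split_ifs
  exacts [Multiset.le_add_right _ _, le_rfl]

theorem mem_subsample {p : Z × ℝ} (hp : p ∈ subsample P F full w add t) :
    ∃ s < t, add s ∧ stepCopies P F full w add s ≠ 0 ∧ w s = p := by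
  induction t with
  | zero => simp [subsample] at hp
  | succ t ih =>
    rw [subsample] at hp
    split_ifs at hp with hadd
    · rcases Multiset.mem_add.1 hp with hp | hp
      · exact (ih hp).imp fun s hs => ⟨hs.1.trans t.lt_succ_self, hs.2⟩
      · obtain ⟨hne, rfl⟩ := Multiset.mem_replicate.1 hp
        exact ⟨t, t.lt_succ_self, hadd, hne, rfl⟩
    · exact (ih hp).imp fun s hs => ⟨hs.1.trans t.lt_succ_self, hs.2⟩

theorem roundedWeight_nonneg (κ σ : ℝ) : 0 ≤ roundedWeight κ σ := by
  unfold roundedWeight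
  split_ifs <;> positivity

theorem roundedWeight_le (hκ : 0 < κ) (σ : ℝ) : roundedWeight κ σ ≤ 1 / σ ^ 2 := by
  unfold roundedWeight
  split_ifs with h
  · positivity
  · exact_mod_cast Int.zpow_log_le_self (b := 2) one_lt_two (hκ.trans_le (not_lt.1 h))

theorem one_div_sq_le_two_mul_roundedWeight {σ : ℝ} (h : κ ≤ 1 / σ ^ 2) :
    1 / σ ^ 2 ≤ 2 * roundedWeight κ σ := by
  have hlog := (Int.lt_zpow_succ_log_self (b := 2) one_lt_two (1 / σ ^ 2)).le
  rw [zpow_add_one₀ (by norm_num)] at hlog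
  rw [roundedWeight, if_neg (not_lt.2 h), mul_comm]
  exact_mod_cast hlog

theorem obsRoundedSq_nonneg (g : Z → ℝ) (s : ℕ) : 0 ≤ obsRoundedSq κ w g s :=
  mul_nonneg (roundedWeight_nonneg _ _) (sq_nonneg _)

theorem obsRoundedSq_le_obsSq (hκ : 0 < κ) (g : Z → ℝ) (s : ℕ) :
    obsRoundedSq κ w g s ≤ obsSq w g s := by
  rw [obsRoundedSq, obsSq, div_eq_mul_one_div, mul_comm]
  exact mul_le_mul_of_nonneg_left (roundedWeight_le hκ _) (sq_nonneg _)

theorem obsSq_le_two_mul_obsRoundedSq_add (hκ : 0 ≤ κ) (g : Z → ℝ) (s : ℕ) :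
    obsSq w g s ≤ 2 * obsRoundedSq κ w g s + κ * g (w s).1 ^ 2 := by
  have hweight : 1 / (w s).2 ^ 2 ≤ 2 * roundedWeight κ (w s).2 + κ := by
    rcases le_total κ (1 / (w s).2 ^ 2) with h | h
    · linarith [one_div_sq_le_two_mul_roundedWeight h]
    · linarith [roundedWeight_nonneg κ (w s).2]
  calc obsSq w g s = 1 / (w s).2 ^ 2 * g (w s).1 ^ 2 := by rw [obsSq]; ring
    _ ≤ (2 * roundedWeight κ (w s).2 + κ) * g (w s).1 ^ 2 := by gcongr
    _ = 2 * obsRoundedSq κ w g s + κ * g (w s).1 ^ 2 := by rw [obsRoundedSq]; ring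

theorem roundedNormSq_subsample_le (hκ : 0 < κ) (g : Z → ℝ) (t : ℕ) :
    roundedNormSq κ (subsample P F full w add t) g ≤ wnormSq (subsample P F full w add t) g := by
  rw [roundedNormSq_subsample, wnormSq_subsample]
  exact sampledSum_le_sampledSum fun s _ => obsRoundedSq_le_obsSq hκ g s

theorem roundedNormSq_mono {D D' : WData Z} (h : D ≤ D') (g : Z → ℝ) :
    roundedNormSq κ D g ≤ roundedNormSq κ D' g := by
  obtain ⟨E, rfl⟩ := Multiset.le_iff_exists_add.1 h
  have hE : 0 ≤ roundedNormSq κ E g := Multiset.sum_nonneg <|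
    Multiset.forall_mem_map_iff.2 fun _ _ => mul_nonneg (roundedWeight_nonneg _ _) (sq_nonneg _)
  simpa [roundedNormSq] using hE

end Subsample

section Copies

variable {q : ℝ}

theorem nonpos_of_copies_eq_zero (hq₁ : q ≤ 1) (h : copies q = 0) : q ≤ 0 := by
  by_contra! hq
  exact (one_le_one_div hq hq₁).not_gt (Nat.floor_eq_zero.1 h)

theorem copies_mul_le_one (hq : 0 ≤ q) : copies q * q ≤ 1 :=
  calc copies q * q ≤ 1 / q * q :=
        mul_le_mul_of_nonneg_right (Nat.floor_le (one_div_nonneg.2 hq)) hq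
    _ ≤ 1 := by rw [one_div_mul_eq_div]; exact div_self_le_one q

theorem one_div_copies_le (hq₀ : 0 ≤ q) (hq₁ : q ≤ 1) : 1 / (copies q : ℝ) ≤ 2 * q := by
  rcases hq₀.eq_or_lt with rfl | hq
  · simp [copies]
  · have hn : (1 : ℝ) ≤ copies q := by
      exact_mod_cast Nat.le_floor (by exact_mod_cast one_le_one_div hq hq₁)
    have hlt : 1 / q < copies q + 1 := Nat.lt_floor_add_one _
    rw [div_lt_iff₀ hq] at hlt
    rw [div_le_iff₀ (by linarith)]
    nlinarith

end Copies

section Sensitivity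

/-- The factor `log(T N / δ)` in the sampling probabilities. -/
def Params.logFactor (P : Params) : ℝ :=
  Real.log (P.T * P.N / P.δ)

variable {Z : Type*} {P : Params} {F : Finset (Z → ℝ)} {D : WData Z} {z : Z} {σ : ℝ}
  {f f' : Z → ℝ}

theorem sensitivity_nonneg : 0 ≤ sensitivity P F D z σ := by
  refine le_min (Real.iSup_nonneg fun f => ?_) zero_le_one
  have hw := wnormSq_nonneg D (f.1.1 - f.2.1)
  positivity

theorem sq_div_le_sensitivity_mul (hβ : 0 < P.β ^ 2) (hf : f ∈ F) (hf' : f' ∈ F)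
    (hs : sensitivity P F D z σ < 1) :
    (f z - f' z) ^ 2 / σ ^ 2 ≤ sensitivity P F D z σ * (wnormSq D (f - f') + P.β ^ 2) := by
  set ratio : F × F → ℝ := fun f => 1 / σ ^ 2 * (f.1.1 z - f.2.1 z) ^ 2 /
    (min (wnormSq D (f.1.1 - f.2.1)) (P.T * (P.H + 1) ^ 2 / P.α ^ 2) + P.β ^ 2)
  have heq : sensitivity P F D z σ = ⨆ f, ratio f :=
    min_eq_left ((min_lt_iff.1 hs).resolve_right (lt_irrefl _)).le
  have hratio : ratio (⟨f, hf⟩, ⟨f', hf'⟩) ≤ sensitivity P F D z σ :=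
    heq ▸ le_ciSup (Set.finite_range ratio).bddAbove _
  have hw := wnormSq_nonneg D (f - f')
  rw [div_le_iff₀ (by positivity)] at hratio
  calc (f z - f' z) ^ 2 / σ ^ 2 = 1 / σ ^ 2 * (f z - f' z) ^ 2 := by ring
    _ ≤ _ := hratio
    _ ≤ sensitivity P F D z σ * (wnormSq D (f - f') + P.β ^ 2) :=
        mul_le_mul_of_nonneg_left (by gcongr; exact min_le_left _ _) sensitivity_nonneg

theorem targetProb_nonneg (hC : 0 ≤ P.C) (hlog : 0 ≤ P.logFactor) :
    0 ≤ targetProb P F D z σ :=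
  le_min zero_le_one (mul_nonneg (mul_nonneg hC sensitivity_nonneg) hlog)

theorem targetProb_le_one : targetProb P F D z σ ≤ 1 :=
  min_le_left _ _

theorem targetProb_le : targetProb P F D z σ ≤ P.C * sensitivity P F D z σ * P.logFactor :=
  min_le_right _ _

theorem mul_sq_div_le_targetProb_mul (hCl : 1 ≤ P.C * P.logFactor) (hβ : 0 < P.β ^ 2)
    (hf : f ∈ F) (hf' : f' ∈ F) (hq : targetProb P F D z σ < 1) :
    P.C * P.logFactor * ((f z - f' z) ^ 2 / σ ^ 2)
      ≤ targetProb P F D z σ * (wnormSq D (f - f') + P.β ^ 2) := by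
  have heq : targetProb P F D z σ = P.C * P.logFactor * sensitivity P F D z σ :=
    (min_eq_right ((min_lt_iff.1 hq).resolve_left (lt_irrefl _)).le).trans (mul_right_comm _ _ _)
  have hs : sensitivity P F D z σ < 1 :=
    (le_mul_of_one_le_left sensitivity_nonneg hCl).trans_lt (heq ▸ hq)
  rw [heq, mul_assoc (P.C * P.logFactor)]
  exact mul_le_mul_of_nonneg_left (sq_div_le_sensitivity_mul hβ hf hf' hs) (by linarith)

theorem sq_div_eq_zero_of_copies_eq_zero (hCl : 1 ≤ P.C * P.logFactor) (hβ : 0 < P.β ^ 2)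
    (hf : f ∈ F) (hf' : f' ∈ F) (hn : copies (targetProb P F D z σ) = 0) :
    (f z - f' z) ^ 2 / σ ^ 2 = 0 := by
  have hq := nonpos_of_copies_eq_zero targetProb_le_one hn
  have hw := wnormSq_nonneg D (f - f')
  have hle : P.C * P.logFactor * ((f z - f' z) ^ 2 / σ ^ 2) ≤ 0 :=
    (mul_sq_div_le_targetProb_mul hCl hβ hf hf' (hq.trans_lt one_pos)).trans
      (mul_nonpos_of_nonpos_of_nonneg hq (by positivity))
  exact le_antisymm (nonpos_of_mul_nonpos_right hle (by linarith)) (by positivity)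

theorem copies_mul_sq_div_le (hC : 0 ≤ P.C) (hCl : 1 ≤ P.C * P.logFactor) (hβ : 0 < P.β ^ 2)
    (hf : f ∈ F) (hf' : f' ∈ F) (hn : 2 ≤ copies (targetProb P F D z σ)) :
    copies (targetProb P F D z σ) * ((f z - f' z) ^ 2 / σ ^ 2)
      ≤ (wnormSq D (f - f') + P.β ^ 2) / (P.C * P.logFactor) := by
  have hlog : 0 ≤ P.logFactor := by by_contra! h; nlinarith
  set q := targetProb P F D z σ
  have hcq : copies q * q ≤ 1 := copies_mul_le_one (targetProb_nonneg hC hlog)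
  have hn₂ : (2 : ℝ) ≤ copies q := by exact_mod_cast hn
  have hq : q < 1 := by by_contra! h; nlinarith
  have hw := wnormSq_nonneg D (f - f')
  rw [le_div_iff₀ (by linarith), mul_assoc, mul_comm _ (P.C * P.logFactor)]
  calc copies q * (P.C * P.logFactor * ((f z - f' z) ^ 2 / σ ^ 2))
      ≤ copies q * (q * (wnormSq D (f - f') + P.β ^ 2)) :=
        mul_le_mul_of_nonneg_left (mul_sq_div_le_targetProb_mul hCl hβ hf hf' hq)
          (Nat.cast_nonneg _)
    _ = copies q * q * (wnormSq D (f - f') + P.β ^ 2) := (mul_assoc _ _ _).symm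
    _ ≤ wnormSq D (f - f') + P.β ^ 2 := mul_le_of_le_one_left (by positivity) hcq

end Sensitivity

section Eluder

variable {Z : Type*} {F : Finset (Z → ℝ)} {lam α : ℝ} {T : ℕ} {w : ℕ → Z × ℝ}

theorem sq_sub_le_uncertaintySq_mul (hlam : 0 < lam) {f f' : Z → ℝ} (hf : f ∈ F) (hf' : f' ∈ F)
    (D : WData Z) (z : Z) :
    (f z - f' z) ^ 2 ≤ uncertaintySq F lam D z * (wnormSq D (f - f') + lam) := by
  have hw := wnormSq_nonneg D (f - f')
  rw [← div_le_iff₀ (by positivity)]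
  exact le_ciSup (f := fun f : F × F =>
      (f.1.1 z - f.2.1 z) ^ 2 / (wnormSq D (f.1.1 - f.2.1) + lam))
    (Set.finite_range _).bddAbove (⟨f, hf⟩, ⟨f', hf'⟩)

theorem uncertaintySq_nonneg (hlam : 0 ≤ lam) (D : WData Z) (z : Z) :
    0 ≤ uncertaintySq F lam D z := by
  refine Real.iSup_nonneg fun f => ?_
  have hw := wnormSq_nonneg D (f.1.1 - f.2.1)
  positivity

theorem eluderSum_le (w : ℕ → Z × ℝ) : eluderSum F lam T w ≤ T :=
  (Finset.sum_le_card_nsmul _ _ 1 fun _ _ => min_le_left _ _).trans_eq (by simp)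

theorem eluderSum_congr {w' : ℕ → Z × ℝ} (h : ∀ s < T, w s = w' s) :
    eluderSum F lam T w = eluderSum F lam T w' := by
  refine Finset.sum_congr rfl fun i hi => ?_
  have hiT : i < T := Finset.mem_range.1 hi
  have hprefix : prefixData w i = prefixData w' i :=
    Multiset.map_congr rfl fun s hs => h s ((Multiset.mem_range.1 hs).trans hiT)
  rw [h i hiT, hprefix]

theorem eluderSum_le_genEluderDim (hα : ∀ s < T, α ≤ (w s).2) :
    eluderSum F lam T w ≤ genEluderDim F lam α T := by
  set w' : ℕ → Z × ℝ := fun s => ((w s).1, max α (w s).2)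
  have hw : eluderSum F lam T w = eluderSum F lam T w' :=
    eluderSum_congr fun s hs => Prod.ext rfl (max_eq_right (hα s hs)).symm
  have hbdd : BddAbove (Set.range fun w : {w : ℕ → Z × ℝ // ∀ i, α ≤ (w i).2} =>
      eluderSum F lam T w.1) := ⟨T, Set.forall_mem_range.2 fun w => eluderSum_le w.1⟩
  exact hw.trans_le (le_ciSup hbdd ⟨w', fun _ => le_max_left _ _⟩)

end Eluder

section GoodPath

/-- The weight `λ / (T L²)` below which an observation is ignored by the bonus. -/
def Params.cutoff (P : Params) (L lam : ℝ) : ℝ :=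
  lam / (P.T * L ^ 2)

/-- The bound on the increments of a sampled squared norm at the dyadic scale `2 ^ i β²`. -/
def Params.incrementBound (P : Params) (i : ℕ) : ℝ :=
  5 * (2 ^ i * P.β ^ 2) / (P.C * P.logFactor)

/-- A number of dyadic scales `2 ^ i β²` that covers all values of `‖f - f'‖² + β²`. -/
def Params.numScales (P : Params) (L lam : ℝ) : ℕ :=
  ⌈2 * (1 + P.T * L ^ 2 / P.α ^ 2 / lam)⌉₊

/-- The standing assumptions on the inputs of the sub-sampling: the functions of `F` take values in
`[0, L]`, `lam` is at most `β²`, and the other parameters are in their meaningful ranges. -/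
structure IsAdmissible {Z : Type*} (P : Params) (F : Finset (Z → ℝ)) (L lam : ℝ) : Prop where
  one_le_C : 1 ≤ P.C
  one_le_logFactor : 1 ≤ P.logFactor
  α_pos : 0 < P.α
  L_pos : 0 < L
  lam_pos : 0 < lam
  lam_le : lam ≤ P.β ^ 2
  nonneg_le : ∀ f ∈ F, ∀ z, 0 ≤ f z ∧ f z ≤ L

/-- The realizations of the data and the coins on which the sub-sample approximates the data: every
truncated squared distance is approximated at every scale, coins of probability one come up, and
neither the number of sampled observations nor the size of the sub-sample is too large. -/
structure IsGoodPath {Z : Type*} (P : Params) (F : Finset (Z → ℝ)) (full : Bool) (L lam : ℝ)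
    (w : ℕ → Z × ℝ) (add : ℕ → Prop) : Prop where
  α_le : ∀ s < P.T, P.α ≤ (w s).2
  upper : ∀ f ∈ F, ∀ f' ∈ F, ∀ i < P.numScales L lam, ∀ t < P.T,
    sampledSum add (stepCopies P F full w add) (truncated (stepCopies P F full w add)
        (P.incrementBound i) (obsSq w (f - f')) (obsSq w (f - f'))) t
      ≤ 2 * ∑ s ∈ Finset.range t, truncated (stepCopies P F full w add)
        (P.incrementBound i) (obsSq w (f - f')) (obsSq w (f - f')) s + 2 ^ i * P.β ^ 2 / 16
  lower : ∀ f ∈ F, ∀ f' ∈ F, ∀ i < P.numScales L lam, ∀ t < P.T,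
    (∑ s ∈ Finset.range t, truncated (stepCopies P F full w add) (P.incrementBound i)
        (obsSq w (f - f')) (obsRoundedSq (P.cutoff L lam) w (f - f')) s) / 2
          - 2 ^ i * P.β ^ 2 / 16
      ≤ sampledSum add (stepCopies P F full w add) (truncated (stepCopies P F full w add)
        (P.incrementBound i) (obsSq w (f - f')) (obsRoundedSq (P.cutoff L lam) w (f - f'))) t
  forced : ∀ s < P.T, stepCopies P F full w add s = 1 → add s
  count_le : sampledSum add (stepCopies P F full w add)
      (fun s => 1 / (stepCopies P F full w add s : ℝ)) P.T
    ≤ 2 * ∑ s ∈ Finset.range P.T, 1 / (stepCopies P F full w add s : ℝ)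
      + Real.log (3 * P.H / P.δ)
  size_le : sampledSum add (stepCopies P F full w add) (fun _ => 1) P.T ≤ 3 * P.T * P.H / P.δ

theorem exists_dyadic_scale {N B : ℝ} (hN : 0 ≤ N) (hB : 0 < B) {I : ℕ}
    (hI : 2 * (1 + N / B) < 2 ^ I) : ∃ i < I, N + B ≤ 2 ^ i * B ∧ 2 ^ i * B ≤ 2 * (N + B) := by
  have hone : 1 ≤ 1 + N / B := le_add_of_nonneg_right (by positivity)
  have hmul : (1 + N / B) * B = N + B := by field_simp; ring
  obtain ⟨i, hi, hi'⟩ := exists_nat_pow_near hone one_lt_two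
  refine ⟨i + 1, ?_, ?_, ?_⟩
  · rw [← pow_lt_pow_iff_right₀ (one_lt_two : (1 : ℝ) < 2), pow_succ]
    linarith
  · rw [← hmul]
    gcongr
  · rw [← hmul, pow_succ]
    nlinarith

variable {Z : Type*} {P : Params} {F : Finset (Z → ℝ)} {full : Bool} {L lam : ℝ}
  {w : ℕ → Z × ℝ} {add : ℕ → Prop} {f f' : Z → ℝ} {s t : ℕ}

namespace IsAdmissible

theorem β_sq_pos (hA : IsAdmissible P F L lam) : 0 < P.β ^ 2 :=
  hA.lam_pos.trans_le hA.lam_le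

theorem one_le_C_mul_logFactor (hA : IsAdmissible P F L lam) : 1 ≤ P.C * P.logFactor :=
  one_le_mul_of_one_le_of_one_le hA.one_le_C hA.one_le_logFactor

theorem T_pos (hA : IsAdmissible P F L lam) : 0 < P.T := by
  refine Nat.pos_of_ne_zero fun hT => ?_
  have h := hA.one_le_logFactor
  norm_num [Params.logFactor, hT] at h

theorem cutoff_pos (hA : IsAdmissible P F L lam) : 0 < P.cutoff L lam :=
  have hT : (0 : ℝ) < P.T := Nat.cast_pos.2 hA.T_pos
  div_pos hA.lam_pos (mul_pos hT (pow_pos hA.L_pos 2))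

theorem sq_sub_le (hA : IsAdmissible P F L lam) (hf : f ∈ F) (hf' : f' ∈ F) (z : Z) :
    (f - f') z ^ 2 ≤ L ^ 2 := by
  have hz := hA.nonneg_le f hf z
  have hz' := hA.nonneg_le f' hf' z
  rw [Pi.sub_apply]
  exact sq_le_sq' (by linarith) (by linarith)

theorem wnormSq_prefixData_le (hA : IsAdmissible P F L lam) (hα : ∀ s < P.T, P.α ≤ (w s).2)
    (hf : f ∈ F) (hf' : f' ∈ F) (ht : t ≤ P.T) :
    wnormSq (prefixData w t) (f - f') ≤ P.T * L ^ 2 / P.α ^ 2 := by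
  have hαpos := hA.α_pos
  calc wnormSq (prefixData w t) (f - f')
      = ∑ s ∈ Finset.range t, obsSq w (f - f') s := wnormSq_prefixData _ _
    _ ≤ ∑ _s ∈ Finset.range t, L ^ 2 / P.α ^ 2 := by
        refine Finset.sum_le_sum fun s hs => ?_
        have hαs := hα s ((Finset.mem_range.1 hs).trans_le ht)
        have hsq := hA.sq_sub_le hf hf' (w s).1
        unfold obsSq
        gcongr
    _ = t * L ^ 2 / P.α ^ 2 := by rw [Finset.sum_const, Finset.card_range, nsmul_eq_mul]; ring
    _ ≤ P.T * L ^ 2 / P.α ^ 2 := by gcongr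

theorem wnormSq_prefixData_le_rounded (hA : IsAdmissible P F L lam) (hf : f ∈ F) (hf' : f' ∈ F)
    (ht : t ≤ P.T) :
    wnormSq (prefixData w t) (f - f')
      ≤ 2 * ∑ s ∈ Finset.range t, obsRoundedSq (P.cutoff L lam) w (f - f') s + lam := by
  have hκ := hA.cutoff_pos
  have hT : (P.T : ℝ) ≠ 0 := Nat.cast_ne_zero.2 hA.T_pos.ne'
  have hL := hA.L_pos.ne'
  calc wnormSq (prefixData w t) (f - f')
      = ∑ s ∈ Finset.range t, obsSq w (f - f') s := wnormSq_prefixData _ _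
    _ ≤ ∑ s ∈ Finset.range t,
          (2 * obsRoundedSq (P.cutoff L lam) w (f - f') s + P.cutoff L lam * L ^ 2) := by
        refine Finset.sum_le_sum fun s _ =>
          (obsSq_le_two_mul_obsRoundedSq_add hκ.le _ s).trans ?_
        have hsq := mul_le_mul_of_nonneg_left (hA.sq_sub_le hf hf' (w s).1) hκ.le
        linarith
    _ = 2 * ∑ s ∈ Finset.range t, obsRoundedSq (P.cutoff L lam) w (f - f') s
          + t * (P.cutoff L lam * L ^ 2) := by
        rw [Finset.sum_add_distrib, Finset.mul_sum, Finset.sum_const, Finset.card_range,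
          nsmul_eq_mul]
    _ ≤ 2 * ∑ s ∈ Finset.range t, obsRoundedSq (P.cutoff L lam) w (f - f') s
          + P.T * (P.cutoff L lam * L ^ 2) := by gcongr
    _ = 2 * ∑ s ∈ Finset.range t, obsRoundedSq (P.cutoff L lam) w (f - f') s + lam := by
        unfold Params.cutoff
        field_simp

theorem exists_scale (hA : IsAdmissible P F L lam) (hα : ∀ s < P.T, P.α ≤ (w s).2)
    (hf : f ∈ F) (hf' : f' ∈ F) (ht : t ≤ P.T) :
    ∃ i < P.numScales L lam, wnormSq (prefixData w t) (f - f') + P.β ^ 2 ≤ 2 ^ i * P.β ^ 2 ∧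
      2 ^ i * P.β ^ 2 ≤ 2 * (wnormSq (prefixData w t) (f - f') + P.β ^ 2) := by
  refine exists_dyadic_scale (wnormSq_nonneg _ _) hA.β_sq_pos ?_
  have hlam := hA.lam_pos
  calc 2 * (1 + wnormSq (prefixData w t) (f - f') / P.β ^ 2)
      ≤ 2 * (1 + P.T * L ^ 2 / P.α ^ 2 / lam) := by
        have hle : wnormSq (prefixData w t) (f - f') / P.β ^ 2
            ≤ P.T * L ^ 2 / P.α ^ 2 / lam :=
          div_le_div₀ (by positivity) (hA.wnormSq_prefixData_le hα hf hf' ht) hlam hA.lam_le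
        linarith
    _ ≤ (P.numScales L lam : ℝ) := Nat.le_ceil _
    _ < (2 : ℝ) ^ P.numScales L lam := by exact_mod_cast Nat.lt_two_pow_self

theorem stepCopies_mul_obsSq_le (hA : IsAdmissible P F L lam) (hf : f ∈ F) (hf' : f' ∈ F)
    (hsub : wnormSq (subsample P F full w add s) (f - f')
      ≤ 4 * (wnormSq (prefixData w s) (f - f') + P.β ^ 2)) {i : ℕ}
    (hi : wnormSq (prefixData w s) (f - f') + P.β ^ 2 ≤ 2 ^ i * P.β ^ 2)
    (hn : 2 ≤ stepCopies P F full w add s) :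
    stepCopies P F full w add s * obsSq w (f - f') s ≤ P.incrementBound i := by
  have hCl := hA.one_le_C_mul_logFactor
  have hN := wnormSq_nonneg (prefixData w s) (f - f')
  have hβ := hA.β_sq_pos
  have href : wnormSq (refData full (prefixData w s) (subsample P F full w add s)) (f - f')
      ≤ 4 * (wnormSq (prefixData w s) (f - f') + P.β ^ 2) := by
    cases full
    · exact hsub
    · change wnormSq (prefixData w s) (f - f') ≤ _
      linarith
  refine (copies_mul_sq_div_le (by linarith [hA.one_le_C]) hCl hβ hf hf' hn).trans ?_
  exact div_le_div_of_nonneg_right (by linarith) (by linarith)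

end IsAdmissible

namespace IsGoodPath

theorem wnormSq_subsample_le (hg : IsGoodPath P F full L lam w add)
    (hA : IsAdmissible P F L lam) (hf : f ∈ F) (hf' : f' ∈ F) (ht : t < P.T) :
    wnormSq (subsample P F full w add t) (f - f')
      ≤ 4 * (wnormSq (prefixData w t) (f - f') + P.β ^ 2) := by
  induction t using Nat.strong_induction_on with
  | _ t ih =>
    obtain ⟨i, hi, hlo, hhi⟩ := hA.exists_scale hg.α_le hf hf' ht.le
    have hsampled := sampledSum_le_of_truncated (obsSq_nonneg _)
      (fun s hs hn => hA.stepCopies_mul_obsSq_le hf hf' (ih s hs (hs.trans ht))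
        (by linarith [wnormSq_prefixData_mono (w := w) (f - f') hs.le]) hn)
      (hg.upper f hf f' hf' i hi t ht)
    rw [← wnormSq_subsample, ← wnormSq_prefixData] at hsampled
    linarith [wnormSq_nonneg (prefixData w t) (f - f'), hA.β_sq_pos]

theorem wnormSq_prefixData_le_rounded (hg : IsGoodPath P F full L lam w add)
    (hA : IsAdmissible P F L lam) (hf : f ∈ F) (hf' : f' ∈ F) (ht : t < P.T) :
    wnormSq (prefixData w t) (f - f')
      ≤ 8 * roundedNormSq (P.cutoff L lam) (subsample P F full w add t) (f - f')
        + 3 * P.β ^ 2 := by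
  obtain ⟨i, hi, hlo, hhi⟩ := hA.exists_scale hg.α_le hf hf' ht.le
  have hincrement : ∀ s < t, 2 ≤ stepCopies P F full w add s →
      stepCopies P F full w add s * obsSq w (f - f') s ≤ P.incrementBound i := fun s hs =>
    hA.stepCopies_mul_obsSq_le hf hf' (hg.wnormSq_subsample_le hA hf hf' (hs.trans ht))
      (by linarith [wnormSq_prefixData_mono (w := w) (f - f') hs.le])
  have hzero : ∀ s < t, stepCopies P F full w add s = 0 →
      obsRoundedSq (P.cutoff L lam) w (f - f') s = 0 := fun s _ hn => by
    have hobs : obsSq w (f - f') s = 0 :=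
      sq_div_eq_zero_of_copies_eq_zero hA.one_le_C_mul_logFactor hA.β_sq_pos hf hf' hn
    exact le_antisymm ((obsRoundedSq_le_obsSq hA.cutoff_pos _ s).trans_eq hobs)
      (obsRoundedSq_nonneg _ s)
  have hsampled := le_sampledSum_of_truncated (obsRoundedSq_nonneg _) hincrement
    (fun s hs => hg.forced s (hs.trans ht)) hzero (hg.lower f hf f' hf' i hi t ht)
  rw [← roundedNormSq_subsample] at hsampled
  linarith [hA.wnormSq_prefixData_le_rounded (w := w) hf hf' ht.le, hA.lam_le]

theorem wnormSq_prefixData_le_refData (hg : IsGoodPath P F full L lam w add)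
    (hA : IsAdmissible P F L lam) (hf : f ∈ F) (hf' : f' ∈ F) (ht : t < P.T) :
    wnormSq (prefixData w t) (f - f')
      ≤ 8 * wnormSq (refData full (prefixData w t) (subsample P F full w add t)) (f - f')
        + 3 * P.β ^ 2 := by
  cases full
  · have hrounded := hg.wnormSq_prefixData_le_rounded hA hf hf' ht
    have hle := roundedNormSq_subsample_le (P := P) (F := F) (full := false) (w := w) (add := add)
      hA.cutoff_pos (f - f') t
    change _ ≤ 8 * wnormSq (subsample P F false w add t) (f - f') + _
    linarith
  · change _ ≤ 8 * wnormSq (prefixData w t) (f - f') + _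
    linarith [wnormSq_nonneg (prefixData w t) (f - f'), hA.β_sq_pos]

theorem wnormSq_prefixData_add_le (hg : IsGoodPath P F full L lam w add)
    (hA : IsAdmissible P F L lam) (hf : f ∈ F) (hf' : f' ∈ F) (ht : t < P.T) :
    wnormSq (prefixData w t) (f - f') + lam
      ≤ (L ^ 2 + 8) * (min (wnormSq (refData full (prefixData w t)
        (subsample P F full w add t)) (f - f')) (P.T * (P.H + 1) ^ 2 / P.α ^ 2) + P.β ^ 2) := by
  set D := refData full (prefixData w t) (subsample P F full w add t)
  have hD := wnormSq_nonneg D (f - f')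
  have hβ := hA.β_sq_pos
  have hlam := hA.lam_le
  have hαpos := hA.α_pos
  rcases min_choice (wnormSq D (f - f')) (P.T * (P.H + 1) ^ 2 / P.α ^ 2) with h | h <;> rw [h]
  · nlinarith [hg.wnormSq_prefixData_le_refData hA hf hf' ht, sq_nonneg L]
  · have hH : (1 : ℝ) ≤ (P.H + 1) ^ 2 := one_le_pow₀ (by linarith [Nat.cast_nonneg (α := ℝ) P.H])
    have hprefix : wnormSq (prefixData w t) (f - f')
        ≤ L ^ 2 * (P.T * (P.H + 1) ^ 2 / P.α ^ 2) :=
      calc wnormSq (prefixData w t) (f - f') ≤ P.T * L ^ 2 / P.α ^ 2 :=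
            hA.wnormSq_prefixData_le hg.α_le hf hf' ht.le
        _ = L ^ 2 * (P.T * 1 / P.α ^ 2) := by ring
        _ ≤ L ^ 2 * (P.T * (P.H + 1) ^ 2 / P.α ^ 2) := by gcongr
    have hM : 0 ≤ P.T * (P.H + 1) ^ 2 / P.α ^ 2 := by positivity
    nlinarith [sq_nonneg L]

theorem sensitivity_le_uncertaintySq (hg : IsGoodPath P F full L lam w add)
    (hA : IsAdmissible P F L lam) (hs : s < P.T) :
    sensitivity P F (refData full (prefixData w s) (subsample P F full w add s)) (w s).1 (w s).2
      ≤ (L ^ 2 + 8)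
        * min 1 (1 / (w s).2 ^ 2 * uncertaintySq F lam (prefixData w s) (w s).1) := by
  have hL := sq_nonneg L
  have hU := uncertaintySq_nonneg (F := F) hA.lam_pos.le (prefixData w s) (w s).1
  have hβ := hA.β_sq_pos
  rw [mul_min_of_nonneg _ _ (by linarith)]
  refine le_min ((min_le_right _ _).trans (by linarith))
    ((min_le_left _ _).trans (Real.iSup_le ?_ (by positivity)))
  rintro ⟨⟨f, hf⟩, ⟨f', hf'⟩⟩
  have hD := wnormSq_nonneg (refData full (prefixData w s) (subsample P F full w add s)) (f - f')
  rw [div_le_iff₀ (by positivity)]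
  calc 1 / (w s).2 ^ 2 * (f (w s).1 - f' (w s).1) ^ 2
      ≤ 1 / (w s).2 ^ 2 * (uncertaintySq F lam (prefixData w s) (w s).1
          * (wnormSq (prefixData w s) (f - f') + lam)) := by
        gcongr
        exact sq_sub_le_uncertaintySq_mul hA.lam_pos hf hf' _ _
    _ ≤ 1 / (w s).2 ^ 2 * (uncertaintySq F lam (prefixData w s) (w s).1
          * ((L ^ 2 + 8) * (min (wnormSq (refData full (prefixData w s)
            (subsample P F full w add s)) (f - f')) (P.T * (P.H + 1) ^ 2 / P.α ^ 2)
              + P.β ^ 2))) := by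
        gcongr
        exact hg.wnormSq_prefixData_add_le hA hf hf' hs
    _ = _ := by ring

theorem sum_one_div_stepCopies_le (hg : IsGoodPath P F full L lam w add)
    (hA : IsAdmissible P F L lam) :
    ∑ s ∈ Finset.range P.T, 1 / (stepCopies P F full w add s : ℝ)
      ≤ 2 * P.C * P.logFactor * (L ^ 2 + 8) * eluderSum F lam P.T w := by
  have hC := hA.one_le_C
  have hlog := hA.one_le_logFactor
  rw [eluderSum, Finset.mul_sum]
  refine Finset.sum_le_sum fun s hs => ?_
  set D := refData full (prefixData w s) (subsample P F full w add s)
  calc 1 / (stepCopies P F full w add s : ℝ)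
      ≤ 2 * targetProb P F D (w s).1 (w s).2 :=
        one_div_copies_le (targetProb_nonneg (by linarith) (by linarith)) targetProb_le_one
    _ ≤ 2 * (P.C * sensitivity P F D (w s).1 (w s).2 * P.logFactor) := by
        gcongr
        exact targetProb_le
    _ ≤ 2 * (P.C * ((L ^ 2 + 8)
          * min 1 (1 / (w s).2 ^ 2 * uncertaintySq F lam (prefixData w s) (w s).1))
            * P.logFactor) := by
        gcongr
        exact hg.sensitivity_le_uncertaintySq hA (Finset.mem_range.1 hs)
    _ = _ := by ring

theorem card_le_of_added (hg : IsGoodPath P F full L lam w add) (hA : IsAdmissible P F L lam)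
    {S : Finset ℕ} (hS : ∀ s ∈ S, s < P.T ∧ add s ∧ stepCopies P F full w add s ≠ 0) :
    (S.card : ℝ) ≤ 4 * P.C * P.logFactor * (L ^ 2 + 8) * genEluderDim F lam P.α P.T
      + Real.log (3 * P.H / P.δ) := by
  have hcoef : 0 ≤ 2 * P.C * P.logFactor * (L ^ 2 + 8) := by
    nlinarith [hA.one_le_C_mul_logFactor, sq_nonneg L]
  have hdim := mul_le_mul_of_nonneg_left (eluderSum_le_genEluderDim (F := F) (lam := lam) hg.α_le)
    hcoef
  linarith [card_le_sampledSum_one_div hS, hg.count_le, hg.sum_one_div_stepCopies_le hA]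

end IsGoodPath

end GoodPath

section Bonus

variable {Z : Type*} {F : Finset (Z → ℝ)} {κ β : ℝ} {D D' : WData Z} {f f' : Z → ℝ}

/-- The gaps at `z` between two functions of `F` that are at squared distance at most `r`, as
measured by `q`. A bonus is the supremum of such a set. -/
def gapValues (F : Finset (Z → ℝ)) (q : (Z → ℝ) → ℝ) (r : ℝ) (z : Z) : Set ℝ :=
  {y : ℝ | ∃ f₁ ∈ F, ∃ f₂ ∈ F, q (f₁ - f₂) ≤ r ∧ y = |f₁ z - f₂ z|}

theorem bddAbove_gapValues (F : Finset (Z → ℝ)) (q : (Z → ℝ) → ℝ) (r : ℝ) (z : Z) :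
    BddAbove (gapValues F q r z) := by
  refine (((F ×ˢ F).finite_toSet.image fun f => |f.1 z - f.2 z|).subset ?_).bddAbove
  rintro y ⟨f₁, h₁, f₂, h₂, -, rfl⟩
  exact ⟨(f₁, f₂), Finset.mem_coe.2 (Finset.mk_mem_product h₁ h₂), rfl⟩

theorem gapValues_nonempty (hF : F.Nonempty) {q : (Z → ℝ) → ℝ} {r : ℝ} (hq : q 0 ≤ r) (z : Z) :
    (gapValues F q r z).Nonempty := by
  obtain ⟨f, hf⟩ := hF
  exact ⟨0, f, hf, f, hf, by rwa [sub_self], by simp⟩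

theorem roundedNormSq_zero : roundedNormSq κ D 0 = 0 := by
  simp [roundedNormSq]

theorem subsampleBonus_nonneg (z : Z) : 0 ≤ subsampleBonus F κ β D z := by
  refine Real.sSup_nonneg ?_
  rintro y ⟨f₁, -, f₂, -, -, rfl⟩
  exact abs_nonneg _

theorem le_subsampleBonus (hf : f ∈ F) (hf' : f' ∈ F)
    (h : roundedNormSq κ D (f - f') ≤ 10 ^ 2 * β ^ 2) (z : Z) :
    |f z - f' z| ≤ subsampleBonus F κ β D z :=
  le_csSup (bddAbove_gapValues F _ _ z) ⟨f, hf, f', hf', h, rfl⟩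

theorem subsampleBonus_le (hF : F.Nonempty) {z : Z} {y : ℝ}
    (h : ∀ f ∈ F, ∀ f' ∈ F, roundedNormSq κ D (f - f') ≤ 10 ^ 2 * β ^ 2 → |f z - f' z| ≤ y) :
    subsampleBonus F κ β D z ≤ y := by
  refine csSup_le (gapValues_nonempty hF (roundedNormSq_zero.trans_le (by positivity)) z) ?_
  rintro _ ⟨f, hf, f', hf', hff', rfl⟩
  exact h f hf f' hf' hff'

theorem subsampleBonus_anti (hF : F.Nonempty) (h : D ≤ D') (z : Z) :
    subsampleBonus F κ β D' z ≤ subsampleBonus F κ β D z :=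
  subsampleBonus_le hF fun _ hf _ hf' hff' =>
    le_subsampleBonus hf hf' ((roundedNormSq_mono h _).trans hff') z

variable {P : Params} {full : Bool} {L lam : ℝ} {w : ℕ → Z × ℝ} {add : ℕ → Prop} {t : ℕ}

theorem IsGoodPath.le_subsampleBonus (hg : IsGoodPath P F full L lam w add)
    (hA : IsAdmissible P F L lam) (hf : f ∈ F) (hf' : f' ∈ F) (ht : t < P.T)
    (h : wnormSq (prefixData w t) (f - f') ≤ P.β ^ 2) (z : Z) :
    |f z - f' z| ≤ subsampleBonus F (P.cutoff L lam) P.β (subsample P F full w add t) z := by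
  refine BonusOracle.le_subsampleBonus hf hf' ?_ z
  calc roundedNormSq (P.cutoff L lam) (subsample P F full w add t) (f - f')
      ≤ wnormSq (subsample P F full w add t) (f - f') :=
        roundedNormSq_subsample_le hA.cutoff_pos _ _
    _ ≤ 4 * (wnormSq (prefixData w t) (f - f') + P.β ^ 2) :=
        hg.wnormSq_subsample_le hA hf hf' ht
    _ ≤ 10 ^ 2 * P.β ^ 2 := by linarith [hA.β_sq_pos]

theorem IsGoodPath.subsampleBonus_le (hg : IsGoodPath P F full L lam w add)
    (hA : IsAdmissible P F L lam) (hF : F.Nonempty) (ht : t < P.T) {K b : ℝ}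
    (hb : P.β ^ 2 ≤ K * (b ^ 2 + lam)) (z : Z) :
    subsampleBonus F (P.cutoff L lam) P.β (subsample P F full w add t) z
      ≤ √(804 * K) * (uncertainty F lam (prefixData w t) z * √(b ^ 2 + lam)) := by
  refine BonusOracle.subsampleBonus_le hF fun f hf f' hf' hff' => ?_
  have hU := uncertaintySq_nonneg (F := F) hA.lam_pos.le (prefixData w t) z
  have hb' : 0 < b ^ 2 + lam := add_pos_of_nonneg_of_pos (sq_nonneg b) hA.lam_pos
  have hK : 0 ≤ K := (pos_of_mul_pos_left (hA.β_sq_pos.trans_le hb) hb'.le).le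
  rw [uncertainty, ← Real.sqrt_mul hU, ← Real.sqrt_mul (by positivity)]
  refine Real.abs_le_sqrt ?_
  calc (f z - f' z) ^ 2
      ≤ uncertaintySq F lam (prefixData w t) z * (wnormSq (prefixData w t) (f - f') + lam) :=
        sq_sub_le_uncertaintySq_mul hA.lam_pos hf hf' _ _
    _ ≤ uncertaintySq F lam (prefixData w t) z * (804 * (K * (b ^ 2 + lam))) := by
        gcongr
        linarith [hg.wnormSq_prefixData_le_rounded hA hf hf' ht, hA.lam_le]
    _ = 804 * K * (uncertaintySq F lam (prefixData w t) z * (b ^ 2 + lam)) := by ring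

end Bonus

section BonusClass

variable {Z : Type*} {a b : ℤ} {k m : ℕ}

/-- A point, the exponent of its rounded weight and its multiplicity; `none` is a void entry. -/
abbrev CodeEntry (Z : Type*) (a b : ℤ) (k : ℕ) := Option (Z × Finset.Icc a b × Fin (k + 1))

/-- The contribution of an entry to the squared norm of `g`. -/
def entrySq (g : Z → ℝ) : CodeEntry Z a b k → ℝ
  | none => 0
  | some (z, j, n) => n.1 * ((2 : ℝ) ^ j.1 * g z ^ 2)

open Classical in
/-- All bonuses obtained from datasets with at most `m` distinct observations, whose rounded weights
are `2 ^ j` with `a ≤ j ≤ b` and whose multiplicities are at most `k`. -/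
def bonusClass [Fintype Z] {H : ℕ} (F : Fin H → Finset (Z → ℝ)) (B : Fin H → ℝ) (a b : ℤ)
    (k m : ℕ) : Finset (Z → ℝ) :=
  Finset.univ.image fun p : Fin H × (Fin m → CodeEntry Z a b k) => fun z =>
    sSup (gapValues (F p.1) (fun g => ∑ i, entrySq g (p.2 i)) (10 ^ 2 * B p.1 ^ 2) z)

theorem card_bonusClass_le [Fintype Z] {H : ℕ} (F : Fin H → Finset (Z → ℝ)) (B : Fin H → ℝ) :
    (bonusClass F B a b k m).card ≤
      H * (Fintype.card Z * ((b + 1 - a).toNat * (k + 1)) + 1) ^ m := by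
  classical
  refine Finset.card_image_le.trans ?_
  simp [Finset.card_univ]

theorem exists_fin_code {ι E : Type*} (S : Finset ι) (hS : S.card ≤ m) (φ : ι → Option E) :
    ∃ c : Fin m → Option E, ∀ ψ : Option E → ℝ, ψ none = 0 →
      ∑ i, ψ (c i) = ∑ s ∈ S, ψ (φ s) := by
  obtain ⟨e⟩ : Nonempty (S ↪ Fin m) :=
    Function.Embedding.nonempty_of_card_le (by simpa using hS)
  refine ⟨Function.extend e (fun s : S => φ s) fun _ => none, fun ψ hψ => ?_⟩
  rw [← Finset.sum_coe_sort S]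
  refine (Fintype.sum_of_injective e e.injective _ _ (fun i hi => ?_) fun s => ?_).symm
  · rw [Function.extend_apply' _ _ _ (by simpa using hi), hψ]
  · rw [e.injective.extend_apply]

theorem exists_entrySq_eq {κ α σ : ℝ} (hκ : 0 < κ) (hα : 0 < α) (hσ : α ≤ σ) (z : Z) {n : ℕ}
    (hn : n ≤ k) : ∃ e : CodeEntry Z (Int.log 2 κ) (Int.log 2 (1 / α ^ 2)) k,
      ∀ g : Z → ℝ, entrySq g e = n * (roundedWeight κ σ * g z ^ 2) := by
  by_cases hκσ : 1 / σ ^ 2 < κ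
  · exact ⟨none, fun g => by rw [entrySq, roundedWeight, if_pos hκσ, zero_mul, mul_zero]⟩
  · have hlow : Int.log 2 κ ≤ Int.log 2 (1 / σ ^ 2) := Int.log_mono_right hκ (not_lt.1 hκσ)
    have hhigh : Int.log 2 (1 / σ ^ 2) ≤ Int.log 2 (1 / α ^ 2) :=
      Int.log_mono_right (hκ.trans_le (not_lt.1 hκσ))
        (one_div_le_one_div_of_le (by positivity) (by gcongr))
    refine ⟨some (z, ⟨_, Finset.mem_Icc.2 ⟨hlow, hhigh⟩⟩, ⟨n, Nat.lt_succ_of_le hn⟩), fun g => ?_⟩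
    rw [roundedWeight, if_neg hκσ]
    rfl

open Classical in
theorem subsampleBonus_mem_bonusClass [Fintype Z] {H : ℕ} (F : Fin H → Finset (Z → ℝ))
    (B : Fin H → ℝ) {κ α : ℝ} (hκ : 0 < κ) (hα : 0 < α) {D : WData Z} (hσ : ∀ p ∈ D, α ≤ p.2)
    (hk : D.card ≤ k) (hm : D.toFinset.card ≤ m) (h : Fin H) :
    subsampleBonus (F h) κ (B h) D ∈
      bonusClass F B (Int.log 2 κ) (Int.log 2 (1 / α ^ 2)) k m := by
  have hentry (p : Z × ℝ) (hp : p ∈ D.toFinset) :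
      ∃ e : CodeEntry Z (Int.log 2 κ) (Int.log 2 (1 / α ^ 2)) k,
        ∀ g : Z → ℝ, entrySq g e = D.count p * (roundedWeight κ p.2 * g p.1 ^ 2) :=
    exists_entrySq_eq hκ hα (hσ p (Multiset.mem_toFinset.1 hp)) p.1
      ((Multiset.count_le_card p D).trans hk)
  choose! φ hφ using hentry
  obtain ⟨c, hc⟩ := exists_fin_code D.toFinset hm φ
  have hnorm : roundedNormSq κ D = fun g => ∑ i, entrySq g (c i) := by
    funext g
    rw [hc (entrySq g) rfl, roundedNormSq, Finset.sum_multiset_map_count]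
    exact Finset.sum_congr rfl fun p hp => by rw [hφ p hp g, nsmul_eq_mul]
  refine Finset.mem_image.2 ⟨(h, c), Finset.mem_univ _, ?_⟩
  funext z
  change sSup (gapValues (F h) (fun g => ∑ i, entrySq g (c i)) _ z)
    = sSup (gapValues (F h) (roundedNormSq κ D) _ z)
  rw [hnorm]

end BonusClass

section GoodSubsample

variable {Z : Type*} {P : Params} {F : Finset (Z → ℝ)} {full : Bool} {L lam : ℝ}
  {w : ℕ → Z × ℝ} {add : ℕ → Prop} {t : ℕ}

namespace IsGoodPath

theorem α_le_of_mem_subsample (hg : IsGoodPath P F full L lam w add) (ht : t < P.T) {p : Z × ℝ}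
    (hp : p ∈ subsample P F full w add t) : P.α ≤ p.2 := by
  obtain ⟨s, hst, -, -, rfl⟩ := mem_subsample hp
  exact hg.α_le s (hst.trans ht)

theorem card_subsample_le (hg : IsGoodPath P F full L lam w add) (ht : t < P.T) :
    (subsample P F full w add t).card ≤ ⌊3 * P.T * P.H / P.δ⌋₊ := by
  refine (Multiset.card_le_card (subsample_mono ht.le)).trans
    (Nat.le_floor (le_trans ?_ hg.size_le))
  rw [← sum_map_subsample fun _ => 1]
  simp

open Classical in
theorem card_toFinset_subsample_le (hg : IsGoodPath P F full L lam w add)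
    (hA : IsAdmissible P F L lam) (ht : t < P.T) :
    ((subsample P F full w add t).toFinset.card : ℝ)
      ≤ 4 * P.C * P.logFactor * (L ^ 2 + 8) * genEluderDim F lam P.α P.T
        + Real.log (3 * P.H / P.δ) := by
  set S := (Finset.range t).filter fun s => add s ∧ stepCopies P F full w add s ≠ 0
  have hsub : (subsample P F full w add t).toFinset ⊆ S.image w := fun p hp => by
    obtain ⟨s, hst, hadd, hn, rfl⟩ := mem_subsample (Multiset.mem_toFinset.1 hp)
    exact Finset.mem_image_of_mem w
      (Finset.mem_filter.2 ⟨Finset.mem_range.2 hst, hadd, hn⟩)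
  have hcard := (Finset.card_le_card hsub).trans Finset.card_image_le
  refine (Nat.cast_le.2 hcard).trans (hg.card_le_of_added hA fun s hs => ?_)
  obtain ⟨hst, hs⟩ := Finset.mem_filter.1 hs
  exact ⟨(Finset.mem_range.1 hst).trans ht, hs⟩

end IsGoodPath

end GoodSubsample

section Sampling

variable {Ω Z : Type*} {m mΩ : MeasurableSpace Ω}

theorem measurable_comp_of_measurableSet_fibers [Finite Z] {z : Ω → Z}
    (hz : ∀ z₀, MeasurableSet[m] {ω | z ω = z₀}) (g : Z → ℝ) :
    Measurable[m] fun ω => g (z ω) := by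
  let _ : MeasurableSpace Z := ⊤
  exact measurable_from_top.comp (measurable_to_countable' hz)

theorem measurable_roundedWeight (κ : ℝ) : Measurable (roundedWeight κ) := by
  have hlog (σ : ℝ) : Int.log 2 (1 / σ ^ 2) = ⌊Real.logb 2 (1 / σ ^ 2)⌋ :=
    (Real.floor_logb_natCast (b := 2) (by positivity)).symm
  have hfloor : Measurable fun σ : ℝ => ⌊Real.logb 2 (1 / σ ^ 2)⌋ := by
    unfold Real.logb
    fun_prop
  unfold roundedWeight
  simp only [hlog]
  exact Measurable.ite (measurableSet_lt (by fun_prop) measurable_const) measurable_const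
    ((measurable_from_top (f := fun k : ℤ => (2 : ℝ) ^ k)).comp hfloor)

theorem measurable_targetProb [Finite Z] (P : Params) (F : Finset (Z → ℝ)) {D : Ω → WData Z}
    {z : Ω → Z} {σ : Ω → ℝ} (hD : ∀ g, Measurable[m] fun ω => wnormSq (D ω) g)
    (hz : ∀ z₀, MeasurableSet[m] {ω | z ω = z₀}) (hσ : Measurable[m] σ) :
    Measurable[m] fun ω => targetProb P F (D ω) (z ω) (σ ω) := by
  have hsens : Measurable[m] fun ω => sensitivity P F (D ω) (z ω) (σ ω) := by
    unfold sensitivity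
    refine Measurable.min (Measurable.iSup fun f => ?_) measurable_const
    have hdiff := measurable_comp_of_measurableSet_fibers hz (f.1.1 - f.2.1)
    have hnorm := hD (f.1.1 - f.2.1)
    simp only [Pi.sub_apply] at hdiff
    fun_prop
  unfold targetProb
  fun_prop

/-- The sub-sampling of an adaptive sequence of observations `w · t`: the observation and the
probability of step `t` are known in the past `𝓖 t`, and `add t` is the event that its coin says
"add". -/
structure IsAdaptiveSampling (μ : Measure Ω) (𝓖 : Filtration ℕ mΩ) (P : Params)
    (F : Finset (Z → ℝ)) (full : Bool) (w : Ω → ℕ → Z × ℝ) (add : ℕ → Set Ω) : Prop where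
  measurableSet_fst_eq : ∀ t < P.T, ∀ z₀, MeasurableSet[𝓖 t] {ω | (w ω t).1 = z₀}
  measurable_snd : ∀ t < P.T, Measurable[𝓖 t] fun ω => (w ω t).2
  α_le : ∀ ω, ∀ t < P.T, P.α ≤ (w ω t).2
  isCoinSequence : IsCoinSequence μ 𝓖 P.T add fun t ω =>
    addProb P F full (w ω) (fun s => ω ∈ add s) t

namespace IsAdaptiveSampling

variable {μ : Measure Ω} {𝓖 : Filtration ℕ mΩ} {P : Params} {F : Finset (Z → ℝ)} {full : Bool}
  {w : Ω → ℕ → Z × ℝ} {add : ℕ → Set Ω} {L lam : ℝ} {f f' : Z → ℝ} {s t : ℕ}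

section Measurability

variable [Finite Z]

theorem measurable_comp_fst (h : IsAdaptiveSampling μ 𝓖 P F full w add) (g : Z → ℝ)
    (hs : s < P.T) : Measurable[𝓖 s] fun ω => g (w ω s).1 :=
  measurable_comp_of_measurableSet_fibers (h.measurableSet_fst_eq s hs) g

theorem measurable_obsSq (h : IsAdaptiveSampling μ 𝓖 P F full w add) (g : Z → ℝ)
    (hs : s < P.T) : Measurable[𝓖 s] fun ω => obsSq (w ω) g s :=
  ((h.measurable_comp_fst g hs).pow_const 2).div ((h.measurable_snd s hs).pow_const 2)

theorem measurable_obsRoundedSq (h : IsAdaptiveSampling μ 𝓖 P F full w add) (κ : ℝ) (g : Z → ℝ)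
    (hs : s < P.T) : Measurable[𝓖 s] fun ω => obsRoundedSq κ (w ω) g s :=
  ((measurable_roundedWeight κ).comp (h.measurable_snd s hs)).mul
    ((h.measurable_comp_fst g hs).pow_const 2)

theorem measurable_wnormSq_prefixData (h : IsAdaptiveSampling μ 𝓖 P F full w add) (g : Z → ℝ)
    (ht : t < P.T) : Measurable[𝓖 t] fun ω => wnormSq (prefixData (w ω) t) g := by
  simp only [wnormSq_prefixData]
  refine Finset.measurable_fun_sum _ fun s hs => ?_
  have hst := Finset.mem_range.1 hs
  exact (h.measurable_obsSq g (hst.trans ht)).mono (𝓖.mono hst.le) le_rfl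

theorem measurable_stepCopies_of_wnormSq (h : IsAdaptiveSampling μ 𝓖 P F full w add)
    (ht : t < P.T) (hsub : ∀ g, Measurable[𝓖 t] fun ω =>
      wnormSq (subsample P F full (w ω) (fun s => ω ∈ add s) t) g) :
    Measurable[𝓖 t] fun ω => stepCopies P F full (w ω) (fun s => ω ∈ add s) t := by
  refine Nat.measurable_floor.comp (measurable_const.div (measurable_targetProb P F
    (fun g => ?_) (h.measurableSet_fst_eq t ht) (h.measurable_snd t ht)))
  cases full
  exacts [hsub g, h.measurable_wnormSq_prefixData g ht]

theorem measurable_wnormSq_subsample (h : IsAdaptiveSampling μ 𝓖 P F full w add) (g : Z → ℝ)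
    (ht : t < P.T) : Measurable[𝓖 t] fun ω =>
      wnormSq (subsample P F full (w ω) (fun s => ω ∈ add s) t) g := by
  induction t using Nat.strong_induction_on generalizing g with
  | _ t ih =>
    simp only [wnormSq_subsample, sampledSum]
    refine Finset.measurable_fun_sum _ fun s hs => ?_
    have hst := Finset.mem_range.1 hs
    have hsT := hst.trans ht
    have hcopies := h.measurable_stepCopies_of_wnormSq hsT fun g => ih s hst g hsT
    have hterm := (measurable_from_top (f := ((↑) : ℕ → ℝ))).comp hcopies |>.mul
      (h.measurable_obsSq g hsT)
    exact Measurable.ite (𝓖.mono hst _ (h.isCoinSequence.measurableSet s hsT))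
      (hterm.mono (𝓖.mono hst.le) le_rfl) measurable_const

theorem measurable_stepCopies (h : IsAdaptiveSampling μ 𝓖 P F full w add) (ht : t < P.T) :
    Measurable[𝓖 t] fun ω => stepCopies P F full (w ω) (fun s => ω ∈ add s) t :=
  h.measurable_stepCopies_of_wnormSq ht fun g => h.measurable_wnormSq_subsample g ht

theorem measurable_truncated (h : IsAdaptiveSampling μ 𝓖 P F full w add) (b : ℝ) (g : Z → ℝ)
    {x : Ω → ℕ → ℝ} (hs : s < P.T) (hx : Measurable[𝓖 s] fun ω => x ω s) :
    Measurable[𝓖 s] fun ω => truncated (stepCopies P F full (w ω) fun s => ω ∈ add s) b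
      (obsSq (w ω) g) (x ω) s := by
  have hcopies := h.measurable_stepCopies hs
  have hcast := (measurable_from_top (f := ((↑) : ℕ → ℝ))).comp hcopies
  exact Measurable.ite ((measurableSet_le measurable_const hcopies).inter
    (measurableSet_le (hcast.mul (h.measurable_obsSq g hs)) measurable_const)) hx measurable_const

end Measurability

end IsAdaptiveSampling

end Sampling

section Failure

theorem IsAdmissible.incrementBound_pos {Z : Type*} {P : Params} {F : Finset (Z → ℝ)} {L lam : ℝ}
    (hA : IsAdmissible P F L lam) (i : ℕ) : 0 < P.incrementBound i := by
  have hCl := hA.one_le_C_mul_logFactor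
  have hβ := hA.β_sq_pos
  unfold Params.incrementBound
  positivity

theorem IsAdmissible.incrementBound_mul {Z : Type*} {P : Params} {F : Finset (Z → ℝ)} {L lam : ℝ}
    (hA : IsAdmissible P F L lam) (i : ℕ) :
    P.incrementBound i * (P.C * P.logFactor / 80) = 2 ^ i * P.β ^ 2 / 16 := by
  have hC := (zero_lt_one.trans_le hA.one_le_C).ne'
  have hlog := (zero_lt_one.trans_le hA.one_le_logFactor).ne'
  unfold Params.incrementBound
  field_simp
  ring

variable {Ω : Type*} {mΩ : MeasurableSpace Ω} {μ : Measure Ω}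

theorem measureReal_not_and_le [IsFiniteMeasure μ] (p q : Ω → Prop) :
    μ.real {ω | ¬(p ω ∧ q ω)} ≤ μ.real {ω | ¬p ω} + μ.real {ω | ¬q ω} := by
  refine (measureReal_mono fun ω hω => ?_).trans (measureReal_union_le _ _)
  exact not_and_or.1 hω

theorem measureReal_not_forall_mem_le {ι : Type*} {S : Finset ι} {q : ι → Ω → Prop} {c : ℝ}
    (hq : ∀ j ∈ S, μ.real {ω | ¬q j ω} ≤ c) :
    μ.real {ω | ¬∀ j ∈ S, q j ω} ≤ S.card * c := by
  have hset : {ω | ¬∀ j ∈ S, q j ω} = ⋃ j ∈ S, {ω | ¬q j ω} := by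
    ext ω
    simp
  rw [hset, ← nsmul_eq_mul]
  exact (measureReal_biUnion_finset_le _ _).trans (Finset.sum_le_card_nsmul _ _ _ hq)

theorem measureReal_not_forall_lt_le {n : ℕ} {q : ℕ → Ω → Prop} {c : ℝ}
    (hq : ∀ j < n, μ.real {ω | ¬q j ω} ≤ c) : μ.real {ω | ¬∀ j < n, q j ω} ≤ n * c := by
  simpa using measureReal_not_forall_mem_le (S := Finset.range n) (by simpa using hq)

namespace IsAdaptiveSampling

variable [IsProbabilityMeasure μ] {Z : Type*} [Finite Z] {𝓖 : Filtration ℕ mΩ} {P : Params}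
  {F : Finset (Z → ℝ)} {full : Bool} {w : Ω → ℕ → Z × ℝ} {add : ℕ → Set Ω} {L lam : ℝ} {t : ℕ}

theorem measureReal_not_upper_le (h : IsAdaptiveSampling μ 𝓖 P F full w add)
    (hA : IsAdmissible P F L lam) (g : Z → ℝ) (i : ℕ) (ht : t < P.T) :
    μ.real {ω | ¬ sampledSum (fun s => ω ∈ add s) (stepCopies P F full (w ω) fun s => ω ∈ add s)
        (truncated (stepCopies P F full (w ω) fun s => ω ∈ add s) (P.incrementBound i)
          (obsSq (w ω) g) (obsSq (w ω) g)) t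
      ≤ 2 * ∑ s ∈ Finset.range t, truncated (stepCopies P F full (w ω) fun s => ω ∈ add s)
          (P.incrementBound i) (obsSq (w ω) g) (obsSq (w ω) g) s + 2 ^ i * P.β ^ 2 / 16}
      ≤ Real.exp (-(P.C * P.logFactor / 80)) := by
  simp only [← hA.incrementBound_mul i, not_le]
  have htail := h.isCoinSequence.measureReal_le_sampledSum_le
    (n := fun s ω => stepCopies P F full (w ω) (fun s => ω ∈ add s) s)
    (fun s hs => h.measurable_stepCopies hs)
    (fun s hs => h.measurable_truncated (P.incrementBound i) g hs (h.measurable_obsSq g hs))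
    (fun s ω => truncated_nonneg (obsSq_nonneg g)) (hA.incrementBound_pos i)
    (fun s ω => mul_truncated_le (hA.incrementBound_pos i).le fun _ => le_rfl) ht.le
    (P.C * P.logFactor / 80)
  exact (measureReal_mono fun ω (hω : _ < _) => Set.mem_ofPred.2 hω.le).trans htail

theorem measureReal_not_lower_le (h : IsAdaptiveSampling μ 𝓖 P F full w add)
    (hA : IsAdmissible P F L lam) (g : Z → ℝ) (i : ℕ) (ht : t < P.T) :
    μ.real {ω | ¬ (∑ s ∈ Finset.range t, truncated (stepCopies P F full (w ω) fun s => ω ∈ add s)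
          (P.incrementBound i) (obsSq (w ω) g) (obsRoundedSq (P.cutoff L lam) (w ω) g) s) / 2
          - 2 ^ i * P.β ^ 2 / 16
      ≤ sampledSum (fun s => ω ∈ add s) (stepCopies P F full (w ω) fun s => ω ∈ add s)
        (truncated (stepCopies P F full (w ω) fun s => ω ∈ add s) (P.incrementBound i)
          (obsSq (w ω) g) (obsRoundedSq (P.cutoff L lam) (w ω) g)) t}
      ≤ Real.exp (-(P.C * P.logFactor / 80)) := by
  simp only [← hA.incrementBound_mul i, not_le]
  have htail := h.isCoinSequence.measureReal_sampledSum_le_le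
    (n := fun s ω => stepCopies P F full (w ω) (fun s => ω ∈ add s) s)
    (fun s hs => h.measurable_stepCopies hs)
    (fun s hs => h.measurable_truncated (P.incrementBound i) g hs
      (h.measurable_obsRoundedSq (P.cutoff L lam) g hs))
    (fun s ω => truncated_nonneg (obsRoundedSq_nonneg g))
    (fun s ω hn => truncated_eq_zero (hn.trans_lt two_pos)) (hA.incrementBound_pos i)
    (fun s ω => mul_truncated_le (hA.incrementBound_pos i).le
      (obsRoundedSq_le_obsSq hA.cutoff_pos g)) ht.le (P.C * P.logFactor / 80)
  exact (measureReal_mono fun ω (hω : _ < _) => Set.mem_ofPred.2 hω.le).trans htail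

theorem measureReal_not_count_le (h : IsAdaptiveSampling μ 𝓖 P F full w add) (l : ℝ) :
    μ.real {ω | ¬ sampledSum (fun s => ω ∈ add s) (stepCopies P F full (w ω) fun s => ω ∈ add s)
        (fun s => 1 / (stepCopies P F full (w ω) (fun s => ω ∈ add s) s : ℝ)) P.T
      ≤ 2 * ∑ s ∈ Finset.range P.T,
          1 / (stepCopies P F full (w ω) (fun s => ω ∈ add s) s : ℝ) + l} ≤ Real.exp (-l) := by
  have htail := h.isCoinSequence.measureReal_le_sampledSum_le
    (n := fun s ω => stepCopies P F full (w ω) (fun s => ω ∈ add s) s)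
    (x := fun s ω => 1 / (stepCopies P F full (w ω) (fun s => ω ∈ add s) s : ℝ))
    (fun s hs => h.measurable_stepCopies hs)
    (fun s hs => measurable_const.div (measurable_from_top.comp (h.measurable_stepCopies hs)))
    (fun s ω => by positivity) one_pos
    (fun s ω => (mul_one_div _ _).trans_le (div_self_le_one _)) le_rfl l
  simp only [not_le, one_mul] at htail ⊢
  exact (measureReal_mono fun ω (hω : _ < _) => Set.mem_ofPred.2 hω.le).trans htail

theorem measureReal_not_size_le (h : IsAdaptiveSampling μ 𝓖 P F full w add) {b : ℝ} (hb : 0 < b) :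
    μ.real {ω | ¬ sampledSum (fun s => ω ∈ add s) (stepCopies P F full (w ω) fun s => ω ∈ add s)
      (fun _ => 1) P.T ≤ b} ≤ P.T / b := by
  have htail := h.isCoinSequence.measureReal_le_sampledSum_one_le
    (fun s hs => h.measurable_stepCopies hs) hb
  simp only [not_le]
  exact (measureReal_mono fun ω (hω : _ < _) => Set.mem_ofPred.2 hω.le).trans htail

theorem measureReal_not_isGoodPath_le (h : IsAdaptiveSampling μ 𝓖 P F full w add)
    (hA : IsAdmissible P F L lam) (hH : 0 < P.H) (hδ : 0 < P.δ) :
    μ.real {ω | ¬ IsGoodPath P F full L lam (w ω) fun s => ω ∈ add s}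
      ≤ 2 * (F.card * (F.card * (P.numScales L lam * (P.T
          * Real.exp (-(P.C * P.logFactor / 80)))))) + 2 * (P.δ / (3 * P.H)) := by
  have hT : (0 : ℝ) < P.T := Nat.cast_pos.2 hA.T_pos
  have hupper := measureReal_not_forall_mem_le (S := F) fun f _ =>
    measureReal_not_forall_mem_le (S := F) fun f' _ =>
      measureReal_not_forall_lt_le (n := P.numScales L lam) fun i _ =>
        measureReal_not_forall_lt_le fun t ht => h.measureReal_not_upper_le hA (f - f') i ht
  have hlower := measureReal_not_forall_mem_le (S := F) fun f _ =>
    measureReal_not_forall_mem_le (S := F) fun f' _ =>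
      measureReal_not_forall_lt_le (n := P.numScales L lam) fun i _ =>
        measureReal_not_forall_lt_le fun t ht => h.measureReal_not_lower_le hA (f - f') i ht
  have hforced := h.isCoinSequence.measureReal_not_add_of_copies_eq_one
    fun s hs => h.measurable_stepCopies hs
  have hcount := h.measureReal_not_count_le (Real.log (3 * P.H / P.δ))
  have hsize := h.measureReal_not_size_le (b := 3 * P.T * P.H / P.δ) (by positivity)
  rw [← Real.log_inv, Real.exp_log (by positivity), inv_div] at hcount
  rw [show P.T / (3 * P.T * P.H / P.δ) = P.δ / (3 * P.H) by field_simp] at hsize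
  refine (measureReal_mono fun ω => mt ?_).trans
    ((measureReal_not_and_le _ _).trans (add_le_add hupper
      ((measureReal_not_and_le _ _).trans (add_le_add hlower
        ((measureReal_not_and_le _ _).trans (add_le_add hforced.le
          ((measureReal_not_and_le _ _).trans (add_le_add hcount hsize)))))))) |>.trans
    (by linarith)
  exact fun ⟨hu, hl, hf, hc, hs⟩ => ⟨h.α_le ω, hu, hl, hf, hc, hs⟩

end IsAdaptiveSampling

end Failure

section Numerics

theorem one_le_log_div {x δ : ℝ} (hx : 1 ≤ x) (hδ : 0 < δ) (hδ' : δ * 12 < 1) :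
    1 ≤ Real.log (x / δ) := by
  rw [Real.le_log_iff_exp_le (by positivity), le_div_iff₀ hδ]
  have hexp := Real.exp_one_lt_d9
  nlinarith

theorem mul_pow_le_exp_mul_log {a y : ℝ} (ha : 0 ≤ a) (hy : 0 < y) (hlog : 1 ≤ Real.log y)
    (k : ℕ) : a * y ^ k ≤ Real.exp ((k + a) * Real.log y) :=
  calc a * y ^ k ≤ Real.exp (a * Real.log y) * y ^ k := by
        have hexp := Real.add_one_le_exp (a * Real.log y)
        gcongr
        nlinarith
    _ = Real.exp ((k + a) * Real.log y) := by
        rw [add_mul, Real.exp_add, Real.exp_nat_mul, Real.exp_log hy, mul_comm]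

theorem log_le_log_add_mul_log {x a b : ℝ} {M : ℕ} (hx : 0 ≤ x) (ha : 1 ≤ a) (hb : 1 ≤ b)
    (h : x ≤ a * b ^ M) : Real.log x ≤ Real.log a + M * Real.log b := by
  rcases hx.eq_or_lt with rfl | hpos
  · have hloga := Real.log_nonneg ha
    have hlogb := Real.log_nonneg hb
    rw [Real.log_zero]
    positivity
  · rw [← Real.log_pow, ← Real.log_mul (by positivity) (by positivity)]
    exact Real.log_le_log hpos h

theorem toNat_log_sub_le {r κ : ℝ} (hr : 0 < r) (hκ : 0 < κ) :
    ((Int.log 2 r + 1 - Int.log 2 κ).toNat : ℝ) ≤ 4 * (r / κ) := by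
  rcases le_or_gt (Int.log 2 r + 1 - Int.log 2 κ) 0 with h | h
  · rw [Int.toNat_of_nonpos h, Nat.cast_zero]
    positivity
  have hr' : (2 : ℝ) ^ Int.log 2 r ≤ r := by
    exact_mod_cast Int.zpow_log_le_self (b := 2) one_lt_two hr
  have hκ' : κ ≤ (2 : ℝ) ^ (Int.log 2 κ + 1) := by
    exact_mod_cast (Int.lt_zpow_succ_log_self (b := 2) one_lt_two κ).le
  calc ((Int.log 2 r + 1 - Int.log 2 κ).toNat : ℝ)
      ≤ 2 ^ (Int.log 2 r + 1 - Int.log 2 κ).toNat := by exact_mod_cast Nat.lt_two_pow_self.le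
    _ = (2 : ℝ) ^ (2 + (Int.log 2 r - (Int.log 2 κ + 1))) := by
        rw [← zpow_natCast, Int.toNat_of_nonneg h.le]
        congr 1
        ring
    _ = 4 * (2 ^ Int.log 2 r / 2 ^ (Int.log 2 κ + 1)) := by
        rw [zpow_add₀ two_ne_zero, zpow_sub₀ two_ne_zero]
        norm_num
    _ ≤ 4 * (r / κ) := by gcongr

end Numerics

section Setting

/-- The constant in the bound `scaleConst L lam * T² H` on the ratios between the largest and the
smallest relevant weight, and between the largest squared distance and `lam`. -/
def scaleConst (L lam : ℝ) : ℝ := 1 + L ^ 2 / lam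

/-- The oversampling constant: large enough for a union bound, over all pairs of functions, scales
and steps, of tails `exp (-(C * logFactor / 80))`. -/
def oversamplingConst (L lam : ℝ) : ℝ := 80 * (3 + 30 * scaleConst L lam)

/-- The constant in the bound on the number of distinct observations in a sub-sample. -/
def distinctConst (L lam : ℝ) : ℝ := 4 * oversamplingConst L lam * (L ^ 2 + 8) + 3

/-- The constant in the bound on the log-cardinality of the bonus class. -/
def classConst (L lam : ℝ) : ℝ := 1 + distinctConst L lam * (3 + 17 * scaleConst L lam)

/-- The standing assumptions of the theorem on the function classes `F`, the threshold `α`, the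
failure probability `δ` and the radii `B` of the sub-sampling. -/
structure IsSetting {Z : Type*} {H : ℕ} (L lam : ℝ) (T : ℕ) (F : Fin H → Finset (Z → ℝ))
    (α δ : ℝ) (B : Fin H → ℝ) : Prop where
  L_pos : 0 < L
  lam_pos : 0 < lam
  one_le_T : 1 ≤ T
  one_le_H : 1 ≤ H
  nonempty : ∀ h, (F h).Nonempty
  nonneg_le : ∀ h, ∀ f ∈ F h, ∀ z, 0 ≤ f z ∧ f z ≤ L
  sqrt_le : √(1 / (T * H)) ≤ α
  δ_pos : 0 < δ
  δ_lt : δ < 1 / ((H : ℝ) ^ 2 + 11)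
  lam_le : ∀ h, lam ≤ B h ^ 2

/-- The inputs of the sub-sampling at level `h`. -/
def levelParams {Z : Type*} {H : ℕ} (L lam : ℝ) (T : ℕ) (F : Fin H → Finset (Z → ℝ))
    (α δ : ℝ) (B : Fin H → ℝ) (h : Fin H) : Params :=
  ⟨T, H, maxCard F, oversamplingConst L lam, B h, α, δ⟩

theorem one_le_scaleConst (L : ℝ) {lam : ℝ} (hlam : 0 < lam) : 1 ≤ scaleConst L lam :=
  le_add_of_nonneg_right (by positivity)

theorem one_le_oversamplingConst (L : ℝ) {lam : ℝ} (hlam : 0 < lam) :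
    1 ≤ oversamplingConst L lam := by
  unfold oversamplingConst
  linarith [one_le_scaleConst L hlam]

theorem distinctConst_pos (L : ℝ) {lam : ℝ} (hlam : 0 < lam) : 0 < distinctConst L lam := by
  have hC := one_le_oversamplingConst L hlam
  unfold distinctConst
  positivity

theorem classConst_pos (L : ℝ) {lam : ℝ} (hlam : 0 < lam) : 0 < classConst L lam := by
  have hD := distinctConst_pos L hlam
  have hG := one_le_scaleConst L hlam
  unfold classConst
  positivity

theorem card_le_maxCard {Z : Type*} {H : ℕ} (F : Fin H → Finset (Z → ℝ)) (h : Fin H) :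
    (F h).card ≤ maxCard F :=
  Finset.le_sup (f := fun h => (F h).card) (Finset.mem_univ h)

theorem genEluderDim_le_max {Z : Type*} {H : ℕ} (F : Fin H → Finset (Z → ℝ)) (lam α : ℝ) (T : ℕ)
    (h : Fin H) : genEluderDim (F h) lam α T ≤ max 1 (⨆ h, genEluderDim (F h) lam α T) :=
  le_max_of_le_right
    (le_ciSup (f := fun h => genEluderDim (F h) lam α T) (Set.finite_range _).bddAbove h)

variable {Z : Type*} {H : ℕ} {L lam : ℝ} {T : ℕ} {F : Fin H → Finset (Z → ℝ)} {α δ : ℝ}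
  {B : Fin H → ℝ}

namespace IsSetting

theorem one_le_T_cast (hS : IsSetting L lam T F α δ B) : (1 : ℝ) ≤ T :=
  Nat.one_le_cast.2 hS.one_le_T

theorem one_le_H_cast (hS : IsSetting L lam T F α δ B) : (1 : ℝ) ≤ H :=
  Nat.one_le_cast.2 hS.one_le_H

theorem one_le_maxCard (hS : IsSetting L lam T F α δ B) : (1 : ℝ) ≤ maxCard F := by
  have hcard := Finset.card_pos.2 (hS.nonempty ⟨0, hS.one_le_H⟩)
  exact_mod_cast hcard.trans_le (card_le_maxCard F _)

theorem α_pos (hS : IsSetting L lam T F α δ B) : 0 < α := by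
  have hT := hS.one_le_T_cast
  have hH := hS.one_le_H_cast
  exact (Real.sqrt_pos.2 (by positivity)).trans_le hS.sqrt_le

theorem one_div_α_sq_le (hS : IsSetting L lam T F α δ B) : 1 / α ^ 2 ≤ T * H := by
  have hα := hS.α_pos
  have hT := hS.one_le_T_cast
  have hH := hS.one_le_H_cast
  exact (one_div_le (by positivity) (by positivity)).1 ((Real.sqrt_le_left hα.le).1 hS.sqrt_le)

theorem δ_mul_lt_one (hS : IsSetting L lam T F α δ B) : δ * ((H : ℝ) ^ 2 + 11) < 1 :=
  (lt_div_iff₀ (by positivity)).1 hS.δ_lt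

theorem δ_mul_twelve_lt_one (hS : IsSetting L lam T F α δ B) : δ * 12 < 1 := by
  nlinarith [hS.δ_mul_lt_one, hS.δ_pos, hS.one_le_H_cast]

theorem H_sq_le (hS : IsSetting L lam T F α δ B) : (H : ℝ) ^ 2 ≤ 1 / δ := by
  rw [le_div_iff₀ hS.δ_pos]
  linarith [hS.δ_mul_lt_one, hS.δ_pos]

theorem one_le_inv_δ (hS : IsSetting L lam T F α δ B) : 1 ≤ 1 / δ :=
  (one_le_pow₀ hS.one_le_H_cast).trans hS.H_sq_le

theorem one_le_div (hS : IsSetting L lam T F α δ B) {x : ℝ} (hx : 1 ≤ x) : 1 ≤ x / δ := by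
  rw [← mul_one_div]
  exact one_le_mul_of_one_le_of_one_le hx hS.one_le_inv_δ

theorem H_le (hS : IsSetting L lam T F α δ B) : (H : ℝ) ≤ 1 / δ :=
  (le_self_pow₀ hS.one_le_H_cast two_ne_zero).trans hS.H_sq_le

theorem one_le_log (hS : IsSetting L lam T F α δ B) : 1 ≤ Real.log (T * maxCard F / δ) :=
  one_le_log_div (one_le_mul_of_one_le_of_one_le hS.one_le_T_cast hS.one_le_maxCard) hS.δ_pos
    hS.δ_mul_twelve_lt_one

theorem isAdmissible (hS : IsSetting L lam T F α δ B) (h : Fin H) :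
    IsAdmissible (levelParams L lam T F α δ B h) (F h) L lam where
  one_le_C := one_le_oversamplingConst L hS.lam_pos
  one_le_logFactor := hS.one_le_log
  α_pos := hS.α_pos
  L_pos := hS.L_pos
  lam_pos := hS.lam_pos
  lam_le := hS.lam_le h
  nonneg_le := hS.nonneg_le h

theorem log_three_mul_div_le (hS : IsSetting L lam T F α δ B) :
    Real.log (3 * H / δ) ≤ 3 * Real.log (T * maxCard F / δ) := by
  have hδ := hS.δ_pos
  have hH := hS.one_le_H_cast
  have hTN := one_le_mul_of_one_le_of_one_le hS.one_le_T_cast hS.one_le_maxCard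
  have hthree : 3 ≤ 1 / δ := by
    rw [le_div_iff₀ hδ]
    linarith [hS.δ_mul_twelve_lt_one]
  calc Real.log (3 * H / δ) ≤ Real.log ((T * maxCard F / δ) ^ 3) := by
        refine Real.log_le_log (by positivity) ?_
        calc 3 * H / δ = 3 * H * (1 / δ) := by ring
          _ ≤ 1 / δ * (1 / δ) * (1 / δ) := by
              gcongr
              exact hS.H_le
          _ = (1 / δ) ^ 3 := by ring
          _ ≤ (T * maxCard F / δ) ^ 3 := by gcongr
    _ = 3 * Real.log (T * maxCard F / δ) := by rw [Real.log_pow, Nat.cast_ofNat]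

theorem one_div_α_sq_div_cutoff_le (hS : IsSetting L lam T F α δ B) :
    1 / α ^ 2 / (lam / (T * L ^ 2)) ≤ scaleConst L lam * T ^ 2 * H := by
  have hlam := hS.lam_pos
  calc 1 / α ^ 2 / (lam / (T * L ^ 2)) = 1 / α ^ 2 * (T * (L ^ 2 / lam)) := by
        rw [div_div_eq_mul_div]
        ring
    _ ≤ T * H * (T * (L ^ 2 / lam)) := by
        gcongr
        exact hS.one_div_α_sq_le
    _ = L ^ 2 / lam * (T ^ 2 * H) := by ring
    _ ≤ scaleConst L lam * (T ^ 2 * H) := by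
        unfold scaleConst
        gcongr
        linarith
    _ = scaleConst L lam * T ^ 2 * H := (mul_assoc _ _ _).symm

theorem numScales_le (hS : IsSetting L lam T F α δ B) (h : Fin H) :
    ((levelParams L lam T F α δ B h).numScales L lam : ℝ)
      ≤ 5 * (scaleConst L lam * T ^ 2 * H) := by
  have hT := hS.one_le_T_cast
  have hH := hS.one_le_H_cast
  have hα := hS.α_pos
  have hlam := hS.lam_pos
  have hone : 1 ≤ scaleConst L lam * T ^ 2 * H := one_le_mul_of_one_le_of_one_le
    (one_le_mul_of_one_le_of_one_le (one_le_scaleConst L hlam) (one_le_pow₀ hT)) hH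
  have hratio : T * L ^ 2 / α ^ 2 / lam ≤ scaleConst L lam * T ^ 2 * H := by
    refine le_of_eq_of_le ?_ hS.one_div_α_sq_div_cutoff_le
    rw [div_div_eq_mul_div]
    ring
  refine (Nat.ceil_lt_add_one ?_).le.trans ?_ <;> dsimp only [levelParams]
  · positivity
  · linarith

theorem mul_cube_mul_exp_le_one (hS : IsSetting L lam T F α δ B) :
    30 * scaleConst L lam * (T * maxCard F / δ) ^ 3
      * Real.exp (-(oversamplingConst L lam * Real.log (T * maxCard F / δ) / 80)) ≤ 1 := by
  have hG := one_le_scaleConst L hS.lam_pos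
  have hT := hS.one_le_T_cast
  have hN := hS.one_le_maxCard
  have hδ := hS.δ_pos
  have hpow := mul_pow_le_exp_mul_log (a := 30 * scaleConst L lam) (by positivity)
    (y := T * maxCard F / δ) (by positivity) hS.one_le_log 3
  have hexponent : oversamplingConst L lam * Real.log (T * maxCard F / δ) / 80
      = ((3 : ℕ) + 30 * scaleConst L lam) * Real.log (T * maxCard F / δ) := by
    unfold oversamplingConst
    push_cast
    ring
  rw [hexponent, Real.exp_neg]
  exact mul_inv_le_one_of_le₀ hpow (Real.exp_pos _).le

theorem two_mul_card_mul_exp_le (hS : IsSetting L lam T F α δ B) (h : Fin H) :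
    2 * ((F h).card * ((F h).card * ((levelParams L lam T F α δ B h).numScales L lam
        * (T * Real.exp (-(oversamplingConst L lam * Real.log (T * maxCard F / δ) / 80))))))
      ≤ δ / (3 * H) := by
  have hT := hS.one_le_T_cast
  have hH := hS.one_le_H_cast
  have hN := hS.one_le_maxCard
  have hδ := hS.δ_pos
  have hG := one_le_scaleConst L hS.lam_pos
  have hcube := hS.mul_cube_mul_exp_le_one
  have hcard : ((F h).card : ℝ) ≤ maxCard F := Nat.cast_le.2 (card_le_maxCard F h)
  have hscales := hS.numScales_le h
  set N : ℝ := ((maxCard F : ℕ) : ℝ)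
  set G := scaleConst L lam
  set E := Real.exp (-(oversamplingConst L lam * Real.log (T * N / δ) / 80))
  have hNH : N ^ 2 * (H : ℝ) ^ 2 ≤ N ^ 3 * (1 / δ) ^ 2 := by
    gcongr
    · norm_num
    · exact hS.H_le
  calc _ ≤ 2 * (N * (N * (5 * (G * T ^ 2 * H) * (T * E)))) := by gcongr
    _ = 30 * G * T ^ 3 * (N ^ 2 * H ^ 2) * E / (3 * H) := by
        field_simp
        ring
    _ ≤ 30 * G * T ^ 3 * (N ^ 3 * (1 / δ) ^ 2) * E / (3 * H) := by gcongr
    _ = 30 * G * (T * N / δ) ^ 3 * E * δ / (3 * H) := by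
        field_simp
    _ ≤ δ / (3 * H) := by
        gcongr
        exact mul_le_of_le_one_left hδ.le hcube

end IsSetting

end Setting

section Oracle

variable {Z : Type*} {H : ℕ} {L lam : ℝ} {T : ℕ} {F : Fin H → Finset (Z → ℝ)}
  {α δ : ℝ} {B : Fin H → ℝ} {Ω : Type*} {mΩ : MeasurableSpace Ω} {μ : Measure Ω}
  [IsProbabilityMeasure μ] {𝓖 : Filtration ℕ mΩ} {full : Bool}

/-- The bound on the number of distinct observations in a sub-sample. -/
def distinctBound (L lam : ℝ) (T : ℕ) (F : Fin H → Finset (Z → ℝ)) (α δ : ℝ) : ℝ :=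
  distinctConst L lam * max 1 (⨆ h, genEluderDim (F h) lam α T) * Real.log (T * maxCard F / δ)

namespace IsSetting

theorem distinctBound_nonneg (hS : IsSetting L lam T F α δ B) :
    0 ≤ distinctBound L lam T F α δ := by
  have hlog := hS.one_le_log
  have hD := distinctConst_pos L hS.lam_pos
  unfold distinctBound
  positivity

theorem distinct_le_distinctBound (hS : IsSetting L lam T F α δ B) (h : Fin H) :
    4 * oversamplingConst L lam * Real.log (T * maxCard F / δ) * (L ^ 2 + 8)
        * genEluderDim (F h) lam α T + Real.log (3 * H / δ) ≤ distinctBound L lam T F α δ := by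
  have hlog := hS.one_le_log
  have hC := one_le_oversamplingConst L hS.lam_pos
  set D := max 1 (⨆ h, genEluderDim (F h) lam α T)
  calc _ ≤ 4 * oversamplingConst L lam * Real.log (T * maxCard F / δ) * (L ^ 2 + 8) * D
          + 3 * (D * Real.log (T * maxCard F / δ)) := by
        gcongr
        · exact genEluderDim_le_max F lam α T h
        · refine hS.log_three_mul_div_le.trans ?_
          gcongr
          exact le_mul_of_one_le_left (by positivity) (le_max_left _ _)
    _ = distinctBound L lam T F α δ := by
        unfold distinctBound distinctConst
        ring

theorem measureReal_not_isGoodPath_le [Finite Z] (hS : IsSetting L lam T F α δ B)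
    {h : Fin H} {w : Ω → ℕ → Z × ℝ} {add : ℕ → Set Ω}
    (hw : IsAdaptiveSampling μ 𝓖 (levelParams L lam T F α δ B h) (F h) full w add) :
    μ.real {ω | ¬ IsGoodPath (levelParams L lam T F α δ B h) (F h) full L lam (w ω)
      fun s => ω ∈ add s} ≤ δ / H := by
  have hH := hS.one_le_H_cast
  calc _ ≤ _ := hw.measureReal_not_isGoodPath_le (hS.isAdmissible h) hS.one_le_H hS.δ_pos
    _ ≤ δ / (3 * H) + 2 * (δ / (3 * H)) :=
      add_le_add_left (hS.two_mul_card_mul_exp_le h) _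
    _ = δ / H := by
      field_simp
      ring

end IsSetting

variable [Fintype Z]

/-- The bonus class of the theorem: it contains all bonuses that occur on good paths. -/
def oracleClass (L lam : ℝ) (T : ℕ) (F : Fin H → Finset (Z → ℝ)) (α δ : ℝ) (B : Fin H → ℝ) :
    Finset (Z → ℝ) :=
  bonusClass F B (Int.log 2 (lam / (T * L ^ 2))) (Int.log 2 (1 / α ^ 2)) ⌊3 * T * H / δ⌋₊
    ⌊distinctBound L lam T F α δ⌋₊

namespace IsSetting

theorem one_le_log_card [Nonempty Z] (hS : IsSetting L lam T F α δ B) :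
    1 ≤ Real.log (T * Fintype.card Z / δ) :=
  one_le_log_div (one_le_mul_of_one_le_of_one_le hS.one_le_T_cast
    (Nat.one_le_cast.2 Fintype.card_pos)) hS.δ_pos hS.δ_mul_twelve_lt_one

theorem log_H_le [Nonempty Z] (hS : IsSetting L lam T F α δ B) :
    Real.log H ≤ Real.log (T * Fintype.card Z / δ) := by
  have hδ := hS.δ_pos
  have hH := hS.one_le_H_cast
  refine Real.log_le_log (by positivity) (hS.H_le.trans ?_)
  gcongr
  exact one_le_mul_of_one_le_of_one_le hS.one_le_T_cast (Nat.one_le_cast.2 Fintype.card_pos)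

theorem card_mul_cube_mul_le [Nonempty Z] (hS : IsSetting L lam T F α δ B) :
    (Fintype.card Z : ℝ) * T ^ 3 * (H ^ 2 / δ) ≤ (T * Fintype.card Z / δ) ^ 3 := by
  have hδ := hS.δ_pos
  have hZ : (1 : ℝ) ≤ Fintype.card Z := Nat.one_le_cast.2 Fintype.card_pos
  calc (Fintype.card Z : ℝ) * T ^ 3 * (H ^ 2 / δ)
      ≤ (Fintype.card Z : ℝ) ^ 3 * T ^ 3 * ((1 / δ) ^ 2 / δ) := by
        gcongr
        · exact le_self_pow₀ hZ three_ne_zero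
        · exact hS.H_le
    _ = (T * Fintype.card Z / δ) ^ 3 := by
        field_simp

theorem card_codes_le [Nonempty Z] (hS : IsSetting L lam T F α δ B) :
    (Fintype.card Z * ((Int.log 2 (1 / α ^ 2) + 1 - Int.log 2 (lam / (T * L ^ 2))).toNat
        * (⌊3 * T * H / δ⌋₊ + 1)) + 1 : ℝ)
      ≤ 17 * scaleConst L lam * (T * Fintype.card Z / δ) ^ 3 := by
  have hT := hS.one_le_T_cast
  have hH := hS.one_le_H_cast
  have hδ := hS.δ_pos
  have hα := hS.α_pos
  have hL := hS.L_pos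
  have hlam := hS.lam_pos
  have hG := one_le_scaleConst L hlam
  have hZ : (1 : ℝ) ≤ Fintype.card Z := Nat.one_le_cast.2 Fintype.card_pos
  have hexponents := (toNat_log_sub_le (r := 1 / α ^ 2) (κ := lam / (T * L ^ 2)) (by positivity)
    (by positivity)).trans (mul_le_mul_of_nonneg_left hS.one_div_α_sq_div_cutoff_le zero_le_four)
  have hmult : (⌊3 * T * H / δ⌋₊ + 1 : ℝ) ≤ 4 * (T * H / δ) := by
    have hfloor := Nat.floor_le (show 0 ≤ 3 * T * H / δ by positivity)
    have hone := hS.one_le_div (one_le_mul_of_one_le_of_one_le hT hH)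
    linarith [show 3 * T * H / δ = 3 * (T * H / δ) by ring]
  have hy := hS.one_le_div (one_le_mul_of_one_le_of_one_le hT hZ)
  calc _ ≤ Fintype.card Z * (4 * (scaleConst L lam * T ^ 2 * H) * (4 * (T * H / δ))) + 1 := by
        gcongr
    _ = 16 * scaleConst L lam * (Fintype.card Z * T ^ 3 * (H ^ 2 / δ)) + 1 := by ring
    _ ≤ 16 * scaleConst L lam * (T * Fintype.card Z / δ) ^ 3
          + scaleConst L lam * (T * Fintype.card Z / δ) ^ 3 := by
        gcongr
        · exact hS.card_mul_cube_mul_le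
        · exact one_le_mul_of_one_le_of_one_le hG (one_le_pow₀ hy)
    _ = 17 * scaleConst L lam * (T * Fintype.card Z / δ) ^ 3 := by ring

theorem card_oracleClass_le [Nonempty Z] (hS : IsSetting L lam T F α δ B) :
    ((oracleClass L lam T F α δ B).card : ℝ)
      ≤ H * (17 * scaleConst L lam * (T * Fintype.card Z / δ) ^ 3)
          ^ ⌊distinctBound L lam T F α δ⌋₊ := by
  refine (Nat.cast_le.2 (card_bonusClass_le F B)).trans ?_
  push_cast
  gcongr
  exact hS.card_codes_le

theorem log_card_oracleClass_le [Nonempty Z] (hS : IsSetting L lam T F α δ B) :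
    Real.log (oracleClass L lam T F α δ B).card
      ≤ classConst L lam * max 1 (⨆ h, genEluderDim (F h) lam α T)
        * Real.log (T * maxCard F / δ) * Real.log (T * Fintype.card Z / δ) := by
  set D := max 1 (⨆ h, genEluderDim (F h) lam α T)
  set ℓ := Real.log (T * maxCard F / δ)
  set ℓ' := Real.log (T * Fintype.card Z / δ)
  set G := scaleConst L lam
  have hℓ : 1 ≤ ℓ := hS.one_le_log
  have hℓ' : 1 ≤ ℓ' := hS.one_le_log_card
  have hG : 1 ≤ G := one_le_scaleConst L hS.lam_pos
  have hDℓ : 1 ≤ D * ℓ := one_le_mul_of_one_le_of_one_le (le_max_left _ _) hℓ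
  have hy : 1 ≤ T * Fintype.card Z / δ := hS.one_le_div (one_le_mul_of_one_le_of_one_le
    hS.one_le_T_cast (Nat.one_le_cast.2 Fintype.card_pos))
  have hcodes := mul_pow_le_exp_mul_log (a := 17 * G) (by positivity) (one_pos.trans_le hy) hℓ' 3
  have hone : 1 ≤ 17 * G * (T * Fintype.card Z / δ) ^ 3 :=
    one_le_mul_of_one_le_of_one_le (by linarith) (one_le_pow₀ hy)
  have hm := hS.distinctBound_nonneg
  calc _ ≤ Real.log H + ⌊distinctBound L lam T F α δ⌋₊
          * Real.log (17 * G * (T * Fintype.card Z / δ) ^ 3) :=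
        log_le_log_add_mul_log (Nat.cast_nonneg _) hS.one_le_H_cast
          hone hS.card_oracleClass_le
    _ ≤ ℓ' + distinctBound L lam T F α δ * (((3 : ℕ) + 17 * G) * ℓ') := by
        gcongr
        · exact hS.log_H_le
        · exact Real.log_nonneg hone
        · exact Nat.floor_le hm
        · exact (Real.log_le_iff_le_exp (by positivity)).2 hcodes
    _ ≤ D * ℓ * ℓ' + distinctBound L lam T F α δ * (((3 : ℕ) + 17 * G) * ℓ') := by
        gcongr
        exact le_mul_of_one_le_left (by positivity) hDℓ
    _ = classConst L lam * D * ℓ * ℓ' := by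
        unfold classConst distinctBound
        push_cast
        ring

theorem isConsistentBonusFamily (hS : IsSetting L lam T F α δ B) {K : ℝ} {β : Fin H → ℕ → ℝ}
    (hβ : ∀ h t, t < T → 0 ≤ β h t ∧ β h t ≤ B h ∧ B h ^ 2 ≤ K * (β h t ^ 2 + lam))
    {w : Fin H → ℕ → Z × ℝ} {add : Fin H → ℕ → Prop}
    (hgood : ∀ h, IsGoodPath (levelParams L lam T F α δ B h) (F h) full L lam (w h) (add h)) :
    IsConsistentBonusFamily (oracleClass L lam T F α δ B) √(804 * K) lam 0 T F w β
      fun h t => subsampleBonus (F h) (lam / (T * L ^ 2)) (B h)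
        (subsample (levelParams L lam T F α δ B h) (F h) full (w h) (add h) t) where
  isBonus h t ht fhat hfhat := by
    have hA := hS.isAdmissible h
    have hL := hS.L_pos
    have hlam := hS.lam_pos
    have hT := hS.one_le_T_cast
    refine ⟨?_, fun z => subsampleBonus_nonneg .., fun z f hf hnorm => ?_, fun z => ?_⟩
    · refine subsampleBonus_mem_bonusClass F B (by positivity) hS.α_pos
        (fun p hp => (hgood h).α_le_of_mem_subsample ht hp)
        ((hgood h).card_subsample_le ht) (Nat.le_floor ?_) h
      exact ((hgood h).card_toFinset_subsample_le hA ht).trans (hS.distinct_le_distinctBound h)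
    · refine (hgood h).le_subsampleBonus hA hf hfhat ht (hnorm.trans ?_) z
      exact pow_le_pow_left₀ (hβ h t ht).1 (hβ h t ht).2.1 2
    · rw [zero_mul, add_zero]
      exact (hgood h).subsampleBonus_le hA (hS.nonempty h) ht (hβ h t ht).2.2 z
  consistent h t t' htt' _ z := subsampleBonus_anti (hS.nonempty h) (subsample_mono htt'.le) z

theorem measure_not_isConsistentBonusFamily_le (hS : IsSetting L lam T F α δ B) {K : ℝ}
    {β : Fin H → ℕ → ℝ}
    (hβ : ∀ h t, t < T → 0 ≤ β h t ∧ β h t ≤ B h ∧ B h ^ 2 ≤ K * (β h t ^ 2 + lam))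
    {w : Fin H → Ω → ℕ → Z × ℝ} {add : Fin H → ℕ → Set Ω}
    (hw : ∀ h, IsAdaptiveSampling μ 𝓖 (levelParams L lam T F α δ B h) (F h) full (w h) (add h)) :
    μ {ω | ¬ IsConsistentBonusFamily (oracleClass L lam T F α δ B) √(804 * K) lam 0 T F
        (fun h => w h ω) β fun h t => subsampleBonus (F h) (lam / (T * L ^ 2)) (B h)
          (subsample (levelParams L lam T F α δ B h) (F h) full (w h ω) (fun s => ω ∈ add h s) t)}
      ≤ ENNReal.ofReal δ := by
  have hH := hS.one_le_H_cast
  have hbad := measureReal_not_forall_mem_le (S := Finset.univ)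
    fun h _ => hS.measureReal_not_isGoodPath_le (hw h)
  rw [Finset.card_univ, Fintype.card_fin, mul_div_cancel₀ δ (by positivity)] at hbad
  rw [← ofReal_measureReal (measure_ne_top _ _)]
  refine ENNReal.ofReal_le_ofReal ((measureReal_mono fun ω => mt fun hgood => ?_).trans hbad)
  exact hS.isConsistentBonusFamily hβ fun h => hgood h (Finset.mem_univ h)

end IsSetting

theorem mainTheorem4_general (L lam : ℝ) (hL : 0 < L) (hlam : 0 < lam) :
    ∃ Calg Cw : ℝ, 1 ≤ Calg ∧ 0 < Cw ∧ ∀ K : ℝ, 0 < K → ∃ Cb : ℝ, 0 < Cb ∧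
    ∀ (Z : Type*) [Fintype Z] [Nonempty Z] (T H : ℕ) (_ : 1 ≤ T) (_ : 1 ≤ H)
      (F : Fin H → Finset (Z → ℝ)) (_ : ∀ h, (F h).Nonempty)
      (_ : ∀ h, ∀ f ∈ F h, ∀ z, 0 ≤ f z ∧ f z ≤ L)
      (α δ : ℝ) (_ : √(1 / (T * H)) ≤ α) (_ : 0 < δ) (_ : δ < 1 / ((H : ℝ) ^ 2 + 11))
      (β : Fin H → ℕ → ℝ) (B : Fin H → ℝ)
      (_ : ∀ h t, t < T → 0 ≤ β h t ∧ β h t ≤ B h ∧ B h ^ 2 ≤ K * (β h t ^ 2 + lam))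
      (_ : ∀ h, lam ≤ B h ^ 2) (full : Bool),
      ∃ W : Finset (Z → ℝ),
        Real.log W.card ≤ Cw * max 1 (⨆ h, genEluderDim (F h) lam α T)
          * Real.log (T * maxCard F / δ) * Real.log (T * Fintype.card Z / δ) ∧
        ∀ (Ω : Type*) [mΩ : MeasurableSpace Ω] (μ : Measure Ω) [IsProbabilityMeasure μ]
          (𝓖 : Filtration ℕ mΩ) (P : Fin H → Params)
          (_ : P = fun h => ⟨T, H, maxCard F, Calg, B h, α, δ⟩)
          (w : Fin H → Ω → ℕ → Z × ℝ) (add : Fin H → ℕ → Set Ω)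
          (_ : ∀ h, IsAdaptiveSampling μ 𝓖 (P h) (F h) full (w h) (add h)),
          μ {ω | ¬ IsConsistentBonusFamily W Cb lam 0 T F (fun h => w h ω) β
              (fun h t => subsampleBonus (F h) (lam / (T * L ^ 2)) (B h)
                (subsample (P h) (F h) full (w h ω) (fun s => ω ∈ add h s) t))}
            ≤ ENNReal.ofReal δ := by
  refine ⟨oversamplingConst L lam, classConst L lam, one_le_oversamplingConst L hlam,
    classConst_pos L hlam, fun K hK => ⟨√(804 * K), by positivity, ?_⟩⟩
  intro Z _ _ T H hT hH F hF hFL α δ hα hδ hδ' β B hβ hB full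
  have hS : IsSetting L lam T F α δ B := ⟨hL, hlam, hT, hH, hF, hFL, hα, hδ, hδ', hB⟩
  refine ⟨oracleClass L lam T F α δ B, hS.log_card_oracleClass_le, ?_⟩
  rintro Ω _ μ _ 𝓖 _ rfl w add hw
  exact hS.measure_not_isConsistentBonusFamily_le hβ hw

end Oracle

end BonusOracle

end

open MeasureTheory BonusOracle in
theorem mainTheorem4 (L lam : ℝ) (hL : 0 < L) (hlam : 0 < lam) :
    ∃ Calg Cw : ℝ, 1 ≤ Calg ∧ 0 < Cw ∧ ∀ K : ℝ, 1 ≤ K → ∃ Cb : ℝ, 0 < Cb ∧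
    ∀ (X A : Type*) [Fintype X] [Fintype A] [Nonempty X] [Nonempty A]
      (T H : ℕ) (_ : 1 ≤ T) (_ : 1 ≤ H)
      (F : Fin H → Finset (X × A → ℝ)) (_ : ∀ h, (F h).Nonempty)
      (_ : ∀ h, ∀ f ∈ F h, ∀ z, 0 ≤ f z ∧ f z ≤ L)
      (α δ : ℝ) (_ : Real.sqrt (1 / (T * H)) ≤ α) (_ : 0 < δ) (_ : δ < 1 / ((H : ℝ) ^ 2 + 11))
      -- the radii of the oracle calls, nondecreasing in `t`, and the radius `B h` with which the
      -- sub-sampling is run at level `h`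
      (β : Fin H → ℕ → ℝ) (B : Fin H → ℝ)
      (_ : ∀ h t, t < T → 0 ≤ β h t ∧ β h t ≤ B h ∧ B h ^ 2 ≤ K * (β h t ^ 2 + lam))
      (_ : ∀ h t t', t ≤ t' → t' < T → β h t ≤ β h t')
      (_ : ∀ h, lam ≤ B h ^ 2)
      (full : Bool),
      ∃ W : Finset (X × A → ℝ),
        Real.log W.card ≤ Cw * max 1 (⨆ h, genEluderDim (F h) lam α T)
          * Real.log (T * maxCard F / δ) * Real.log (T * Fintype.card (X × A) / δ) ∧
        -- an arbitrary adaptive data process: `𝓖 t` is all that is known just before the coins of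
        -- step `t` are tossed, `add h t` is the event that the coin at `(h, t)` says "add"
        ∀ (Ω : Type*) [mΩ : MeasurableSpace Ω] (μ : Measure Ω) [IsProbabilityMeasure μ]
          (𝓖 : Filtration ℕ mΩ)
          (z : Fin H → ℕ → Ω → X × A) (σ : Fin H → ℕ → Ω → ℝ) (add : Fin H → ℕ → Set Ω)
          (w : Fin H → Ω → ℕ → (X × A) × ℝ) (_ : w = fun h ω t => (z h t ω, σ h t ω))
          (P : Fin H → Params) (_ : P = fun h => ⟨T, H, maxCard F, Calg, B h, α, δ⟩)
          (_ : ∀ h t, t < T → ∀ z₀, MeasurableSet[𝓖 t] {ω | z h t ω = z₀})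
          (_ : ∀ h t, t < T → Measurable[𝓖 t] (σ h t))
          (_ : ∀ h t, t < T → ∀ ω, α ≤ σ h t ω)
          (_ : ∀ h t, t < T → MeasurableSet[𝓖 (t + 1)] (add h t))
          (_ : ∀ h t, t < T → μ[(add h t).indicator (fun _ => (1 : ℝ)) | 𝓖 t] =ᵐ[μ]
            fun ω => addProb (P h) (F h) full (w h ω) (fun s => ω ∈ add h s) t),
          μ {ω | ¬ IsConsistentBonusFamily W Cb lam 0 T F (fun h => w h ω) β
              (fun h t => subsampleBonus (F h) (lam / (T * L ^ 2)) (B h)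
                (subsample (P h) (F h) full (w h ω) (fun s => ω ∈ add h s) t))}
            ≤ ENNReal.ofReal δ := by
  obtain ⟨Calg, Cw, hC, hCw, h⟩ := mainTheorem4_general L lam hL hlam
  refine ⟨Calg, Cw, hC, hCw, fun K hK => (h K (one_pos.trans_le hK)).imp fun Cb ⟨hCb, hW⟩ =>
    ⟨hCb, ?_⟩⟩
  intro X A _ _ _ _ T H hT hH F hF hFL α δ hα hδ hδ' β B hβ _ hB full
  refine (hW (X × A) T H hT hH F hF hFL α δ hα hδ hδ' β B hβ hB full).imp
    fun W ⟨hcard, hbad⟩ => ⟨hcard, ?_⟩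
  rintro Ω _ μ _ 𝓖 z σ add _ rfl P rfl hz hσ hσα hadd hp
  exact hbad Ω μ 𝓖 _ rfl _ add fun h => ⟨hz h, hσ h, fun ω t ht => hσα h t ht ω, hadd h, hp h⟩
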